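/- **Conventions.** Let $\Omega$ be the category of finite rooted trees: a tree $T$ is given by a finite set of edges, partially ordered with the root as smallest element and such that the edges below a given edge are linearly ordered, together with a set of maximal edges called leaves; a morphism $S\to T$ is a map of coloured symmetric operads $\Omega(S)\to\Omega(T)$ between the operads freely generated by the vertices of the trees. A vertex without inputs is called a stump. A tree is *closed* if it has no leaves; $\Omega_{cl}\subseteq\Omega$ is the full subcategory of closed trees, and a *closed dendroidal set* is a presheaf of sets on $\Omega_{cl}$. A tree is identified with the presheaf it represents. A *shuffle* of closed trees $S$ and $T$ is a closed tree whose edges are labelled by pairs $(s,t)$ of an edge of $S$ and an edge of $T$, whose root is labelled by the pair of roots, and in which the vertex on top of an edge labelled $(s,t)$ is either a copy of the vertex of $S$ on top of $s$ (with inputs labelled bijectively by the pairs $(s',t)$, $s'$ an input of that vertex) or a copy of the vertex of $T$ on top of $t$ (with inputs labelled by the pairs $(s,t')$). The tensor product $S\otimes T$ is the union of all these shuffles, and $X\otimes Y$ for closed dendroidal sets $X$ and $Y$ is the extension of this tensor product that preserves colimits in each variable, $X\otimes Y=\int^{S,T}X_S\times Y_T\times(S\otimes T)$. A monomorphism $X\rightarrowtail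 Y$ of closed dendroidal sets is *normal* if for every closed tree $T$ the group $\mathrm{Aut}(T)$ acts freely on the complement of $X_T$ in $Y_T$. An edge $e$ of a closed tree $T$ is *very inner* if it is not the root and the vertex on top of it is not a stump. The closed faces of $T$ are its inner faces (one for each edge other than the root, contracting that edge) and, if the root vertex has exactly one input, the root face (which removes the root edge); the *very inner horn* $\Lambda^e_{cl}T\subseteq T$ is the union of all the closed faces except the one contracting $e$. A morphism is *very inner anodyne* (a *via morphism*) if it lies in the saturation of the set of very inner horn inclusions $\Lambda^e_{cl}T\rightarrowtail T$ (all closed trees $T$, all very inner edges $e$ of $T$), i.e. in the smallest class of morphisms which contains these and is closed under pushouts, transfinite compositions and retracts. **Proposition.** Let $U\rightarrowtail X$ and $V\rightarrowtail Y$ be normal monomorphisms between closed dendroidal sets. If at least one of these is a via morphism, then so is the pushout-product map $$U\otimes Y\cup X\otimes V\longrightarrow X\otimes Y,$$ where $\cup$ denotes the pushout under $U\otimes V$. -/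

import Mathlib

open CategoryTheory

noncomputable section

namespace Dendroidal

/-! ### Trees and the category of trees -/

/-- A finite rooted tree in the sense of the theory of dendroidal sets. It is given by its finite
set of edges, partially ordered so that the root edge is the smallest one and the edges below any
given edge are linearly ordered, and by a set of maximal edges, the leaves. Every edge `e` which is
not a leaf has a vertex on top of it, whose input edges are the edges covering `e`; if there are
none, this vertex is a stump. (The edges are numbered, so that the trees form a small category.) -/
structure Tree where
  numEdges : ℕ
  le : Fin numEdges → Fin numEdges → Prop
  le_refl : ∀ a, le a a
  le_trans : ∀ a b c, le a b → le b c → le a c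
  le_antisymm : ∀ a b, le a b → le b a → a = b
  root : Fin numEdges
  root_le : ∀ a, le root a
  total_below : ∀ a b c, le a c → le b c → le a b ∨ le b a
  leaves : Set (Fin numEdges)
  leaves_maximal : ∀ l ∈ leaves, ∀ a, le l a → a = l

namespace Tree

/-- The type of edges of a tree. -/
def Edge (T : Tree) : Type := Fin T.numEdges

instance (T : Tree) : PartialOrder T.Edge where
  le a b := T.le a b
  le_refl := T.le_refl
  le_trans := T.le_trans
  le_antisymm := T.le_antisymm

instance (T : Tree) : OrderBot T.Edge where
  bot := T.root
  bot_le := T.root_le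

instance (T : Tree) : Finite T.Edge := inferInstanceAs (Finite (Fin T.numEdges))

/-- The input edges of the vertex on top of the edge `e`, i.e. the edges immediately above `e`. -/
def inputs (T : Tree) (e : T.Edge) : Set T.Edge := {a | e ⋖ a}

/-- `T.IsOp A e` means that there is a subtree of `T` with root edge `e` and set of leaves `A`. Such
a subtree is unique. So for distinct edges `a₁, …, aₙ`, the set of operations `(a₁, …, aₙ; e)` of
the coloured symmetric operad `Ω(T)` freely generated by the vertices of `T` is a singleton if
`T.IsOp {a₁, …, aₙ} e`, and it is empty otherwise; there are no operations with a repeated input. -/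
structure IsOp (T : Tree) (A : Set T.Edge) (e : T.Edge) : Prop where
  le_of_mem : ∀ a ∈ A, e ≤ a
  antichain : IsAntichain (· ≤ ·) A
  exists_le_leaf : ∀ l : T.Edge, l ∈ T.leaves → e ≤ l → ∃ a ∈ A, a ≤ l

/-- A morphism of trees `S ⟶ T`, i.e. a map of coloured operads `Ω(S) → Ω(T)`: a map between the
sets of edges (the colours) which sends the operations of `Ω(S)` to operations of `Ω(T)`. -/
@[ext]
structure Hom (S T : Tree) where
  toFun : S.Edge → T.Edge
  map_op : ∀ (A : Set S.Edge) (e : S.Edge), S.IsOp A e →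
    Set.InjOn toFun A ∧ T.IsOp (toFun '' A) (toFun e)

/-- The category `Ω` of trees. -/
instance : SmallCategory Tree where
  Hom := Hom
  id T := ⟨id, fun A e h => ⟨Function.injective_id.injOn, by simpa using h⟩⟩
  comp f g := ⟨g.toFun ∘ f.toFun, fun A e h => by
    obtain ⟨hf, hA⟩ := f.map_op A e h
    obtain ⟨hg, hB⟩ := g.map_op _ _ hA
    refine ⟨hg.comp hf (Set.mapsTo_image _ _), ?_⟩
    rw [Set.image_comp]
    exact hB⟩

/-- A tree is closed if it has no leaves. -/
def IsClosed : ObjectProperty Tree := fun T => T.leaves = ∅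

end Tree

/-- The category `Ω_cl` of closed trees, a full subcategory of the category of trees. -/
abbrev ClosedTree : Type := Tree.IsClosed.FullSubcategory

namespace ClosedTree

/-- The edges of a closed tree. -/
abbrev Edge (T : ClosedTree) : Type := T.obj.Edge

/-- The map on edges given by a morphism of closed trees. -/
abbrev onEdges {S T : ClosedTree} (f : S ⟶ T) : S.Edge → T.Edge := f.hom.toFun

/-- The input edges of the vertex on top of the edge `e`. -/
abbrev inputs (T : ClosedTree) (e : T.Edge) : Set T.Edge := T.obj.inputs e

/-- An inner edge of a closed tree is any edge other than the root (there are no leaves). It is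
very inner if it is not attached to a stump, i.e. if the vertex on top of it has an input. -/
def IsVeryInner (T : ClosedTree) (e : T.Edge) : Prop := e ≠ ⊥ ∧ (T.inputs e).Nonempty

/-- `δ : F ⟶ T` is the closed elementary face of `T` which misses the edge `d` and no other edge.
For an inner edge `d` this is the inner face contracting `d`; for the root edge `d` this is the
root face, which exists only if the root vertex has exactly one input. -/
def IsFace {F T : ClosedTree} (δ : F ⟶ T) (d : T.Edge) : Prop :=
  Function.Injective (onEdges δ) ∧ Set.range (onEdges δ) = {d}ᶜ

/-! Morphisms of closed trees in terms of the order. -/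

lemma isOp_iff {T : ClosedTree} (A : Set T.Edge) (e : T.Edge) :
    T.obj.IsOp A e ↔ (∀ a ∈ A, e ≤ a) ∧ IsAntichain (· ≤ ·) A := by
  refine ⟨fun h => ⟨h.1, h.2⟩, fun h => ⟨h.1, h.2, fun l hl => ?_⟩⟩
  have := T.property
  change T.obj.leaves = ∅ at this
  rw [this] at hl
  exact hl.elim

/-- Two edges are incomparable. -/
def Incomp {P : Type*} [LE P] (a b : P) : Prop := ¬ a ≤ b ∧ ¬ b ≤ a

lemma onEdges_mono {S T : ClosedTree} (f : S ⟶ T) {a b : S.Edge} (h : a ≤ b) :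
    onEdges f a ≤ onEdges f b := by
  have := (f.hom.map_op {b} a ((isOp_iff _ _).2 ⟨by simpa using h, by simp⟩)).2.le_of_mem
  simpa using this

lemma onEdges_incomp {S T : ClosedTree} (f : S ⟶ T) {a b : S.Edge} (h : Incomp a b) :
    Incomp (onEdges f a) (onEdges f b) := by
  have hab : a ≠ b := fun e => h.1 e.le
  obtain ⟨h1, h2⟩ := f.hom.map_op {a, b} ⊥ ((isOp_iff _ _).2 ⟨by simp, by
    rintro x (rfl | rfl) y (rfl | rfl) hxy
    · exact (hxy rfl).elim
    · exact h.1
    · exact h.2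
    · exact (hxy rfl).elim⟩)
  have hne : f.hom.toFun a ≠ f.hom.toFun b := fun e => hab (h1 (by simp) (by simp) e)
  exact ⟨h2.antichain ⟨a, by simp, rfl⟩ ⟨b, by simp, rfl⟩ hne,
    h2.antichain ⟨b, by simp, rfl⟩ ⟨a, by simp, rfl⟩ hne.symm⟩

/-- A map on edges preserving the order and incomparability is a morphism of closed trees. -/
def mkHom {S T : ClosedTree} (f : S.Edge → T.Edge) (hf : Monotone f)
    (hf' : ∀ a b, Incomp a b → Incomp (f a) (f b)) : S ⟶ T :=
  ObjectProperty.homMk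
    { toFun := f
      map_op := fun A e h => by
        rw [isOp_iff] at h
        refine ⟨fun a ha b hb hab => ?_, (isOp_iff _ _).2 ⟨?_, ?_⟩⟩
        · by_contra hne
          exact (hf' a b ⟨h.2 ha hb hne, h.2 hb ha (Ne.symm hne)⟩).1 hab.le
        · rintro _ ⟨a, ha, rfl⟩
          exact hf (h.1 a ha)
        · rintro _ ⟨a, ha, rfl⟩ _ ⟨b, hb, rfl⟩ hab
          have hne : a ≠ b := fun e => hab (e ▸ rfl)
          exact (hf' a b ⟨h.2 ha hb hne, h.2 hb ha (Ne.symm hne)⟩).1 }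

lemma total_below (T : ClosedTree) {a b c : T.Edge} (h : a ≤ c) (h' : b ≤ c) : a ≤ b ∨ b ≤ a :=
  T.obj.total_below a b c h h'

/-- Two distinct inputs of the same vertex are not below a common edge. -/
lemma eq_of_covBy (T : ClosedTree) {x a b c : T.Edge} (ha : x ⋖ a) (hb : x ⋖ b) (hac : a ≤ c)
    (hbc : b ≤ c) : a = b := by
  rcases T.total_below hac hbc with h | h
  · rcases h.lt_or_eq with h | h
    · exact (hb.2 ha.1 h).elim
    · exact h
  · rcases h.lt_or_eq with h | h
    · exact (ha.2 hb.1 h).elim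
    · exact h.symm

lemma exists_covBy_le (T : ClosedTree) {x y : T.Edge} (h : x < y) : ∃ a, x ⋖ a ∧ a ≤ y :=
  exists_covBy_le_of_lt h

/-- The closed tree with a given finite poset of edges. -/
def ofPoset (P : Type) [Finite P] [PartialOrder P] [OrderBot P]
    (hP : ∀ a b c : P, a ≤ c → b ≤ c → a ≤ b ∨ b ≤ a) : ClosedTree where
  obj :=
    { numEdges := Nat.card P
      le := fun i j => (Finite.equivFin P).symm i ≤ (Finite.equivFin P).symm j
      le_refl := fun _ => le_rfl
      le_trans := fun _ _ _ h h' => h.trans h'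
      le_antisymm := fun _ _ h h' => (Finite.equivFin P).symm.injective (h.antisymm h')
      root := Finite.equivFin P ⊥
      root_le := fun a => by simp
      total_below := fun a b c h h' => hP _ _ _ h h'
      leaves := ∅
      leaves_maximal := fun l hl => hl.elim }
  property := rfl

/-- The edges of `ofPoset P hP` are the elements of `P`. -/
def ofPosetIso (P : Type) [Finite P] [PartialOrder P] [OrderBot P]
    (hP : ∀ a b c : P, a ≤ c → b ≤ c → a ≤ b ∨ b ≤ a) : (ofPoset P hP).Edge ≃o P where
  toEquiv := (Finite.equivFin P).symm
  map_rel_iff' := Iff.rfl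

end ClosedTree

open ClosedTree

/-! ### Shuffles and the tensor product of closed trees -/

/-- A shuffle of two closed trees `S` and `T`: a closed tree whose edges are labelled by pairs
`(s, t)` of an edge of `S` and an edge of `T`, such that the root is labelled by the pair of roots,
and such that the vertex on top of an edge labelled `(s, t)` is either a copy of the vertex of `S`
on top of `s` (its inputs are labelled bijectively by the pairs `(s', t)`, for `s'` an input of that
vertex), or a copy of the vertex of `T` on top of `t` (likewise, with the pairs `(s, t')`). -/
structure Shuffle (S T : ClosedTree) where
  tree : ClosedTree
  label : tree.Edge → S.Edge × T.Edge
  label_root : label ⊥ = (⊥, ⊥)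
  label_inputs : ∀ a,
    Set.BijOn label (tree.inputs a) {x | x.1 ∈ S.inputs (label a).1 ∧ x.2 = (label a).2} ∨
    Set.BijOn label (tree.inputs a) {x | x.1 = (label a).1 ∧ x.2 ∈ T.inputs (label a).2}

/-- A map from the edges of a closed tree `R` to pairs of edges of `S` and `T` is a dendrex of
`S ⊗ T` if it is given by a morphism from `R` to some shuffle of `S` and `T`. -/
def IsTensorDendrex {R S T : ClosedTree} (φ : R.Edge → S.Edge × T.Edge) : Prop :=
  ∃ (A : Shuffle S T) (k : R ⟶ A.tree), ∀ e, φ e = A.label (onEdges k e)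

namespace Shuffle

variable {S T : ClosedTree}

lemma label_le_of_covBy (A : Shuffle S T) {a b : A.tree.Edge} (h : a ⋖ b) :
    A.label a ≤ A.label b := by
  rcases A.label_inputs a with h' | h'
  · obtain ⟨h1, h2⟩ := h'.1 (show b ∈ A.tree.inputs a from h)
    exact ⟨(show _ ⋖ _ from h1).le, h2.ge⟩
  · obtain ⟨h1, h2⟩ := h'.1 (show b ∈ A.tree.inputs a from h)
    exact ⟨h1.ge, (show _ ⋖ _ from h2).le⟩

lemma label_mono (A : Shuffle S T) : Monotone A.label := by
  intro a b hab
  induction a using WellFoundedGT.induction with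
  | ind a ih =>
    rcases hab.lt_or_eq with h | rfl
    · obtain ⟨c, hc, hcb⟩ := A.tree.exists_covBy_le h
      exact (A.label_le_of_covBy hc).trans (ih c hc.1 hcb)
    · exact le_rfl

/-- Incomparable edges of a shuffle have incomparable labels in one of the two coordinates. -/
lemma label_incomp (A : Shuffle S T) {a b : A.tree.Edge} (h : Incomp a b) :
    Incomp (A.label a).1 (A.label b).1 ∨ Incomp (A.label a).2 (A.label b).2 := by
  obtain ⟨m, hm⟩ := Set.Finite.exists_maximal (s := {m : A.tree.Edge | m ≤ a ∧ m ≤ b})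
    (Set.toFinite _) ⟨⊥, bot_le, bot_le⟩
  have ha : m < a := hm.1.1.lt_of_ne (by rintro rfl; exact h.1 hm.1.2)
  have hb : m < b := hm.1.2.lt_of_ne (by rintro rfl; exact h.2 hm.1.1)
  obtain ⟨c, hc, hca⟩ := A.tree.exists_covBy_le ha
  obtain ⟨d, hd, hdb⟩ := A.tree.exists_covBy_le hb
  have hcd : c ≠ d := by
    rintro rfl
    exact hc.1.not_ge (hm.2 ⟨hca, hdb⟩ hc.1.le)
  have hca' := A.label_mono hca
  have hdb' := A.label_mono hdb
  rcases A.label_inputs m with h' | h'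
  · left
    obtain ⟨c1, c2⟩ := h'.1 (show c ∈ A.tree.inputs m from hc)
    obtain ⟨d1, d2⟩ := h'.1 (show d ∈ A.tree.inputs m from hd)
    have key : (A.label c).1 ≠ (A.label d).1 := fun e =>
      hcd (h'.2.1 hc hd (Prod.ext e (c2.trans d2.symm)))
    exact ⟨fun k => key (S.eq_of_covBy c1 d1 (hca'.1.trans k) hdb'.1),
      fun k => key (S.eq_of_covBy c1 d1 hca'.1 (hdb'.1.trans k))⟩
  · right
    obtain ⟨c1, c2⟩ := h'.1 (show c ∈ A.tree.inputs m from hc)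
    obtain ⟨d1, d2⟩ := h'.1 (show d ∈ A.tree.inputs m from hd)
    have key : (A.label c).2 ≠ (A.label d).2 := fun e =>
      hcd (h'.2.1 hc hd (Prod.ext (c1.trans d1.symm) e))
    exact ⟨fun k => key (T.eq_of_covBy c2 d2 (hca'.2.trans k) hdb'.2),
      fun k => key (T.eq_of_covBy c2 d2 hca'.2 (hdb'.2.trans k))⟩

/-! Construction of a shuffle from a choice of `S` or `T` at each pair of edges. -/

/-- One step upwards: in the direction of `S` if `c` holds, in the direction of `T` otherwise. -/
def Step (c : S.Edge × T.Edge → Prop) (x y : S.Edge × T.Edge) : Prop :=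
  (c x ∧ x.1 ⋖ y.1 ∧ y.2 = x.2) ∨ (¬ c x ∧ y.1 = x.1 ∧ x.2 ⋖ y.2)

/-- Reachability by upward steps. -/
abbrev Reach (c : S.Edge × T.Edge → Prop) (x y : S.Edge × T.Edge) : Prop :=
  Relation.ReflTransGen (Step c) x y

lemma Step.le {c : S.Edge × T.Edge → Prop} {x y : S.Edge × T.Edge} (h : Step c x y) : x ≤ y := by
  rcases h with ⟨-, h1, h2⟩ | ⟨-, h1, h2⟩
  · exact ⟨h1.le, h2.ge⟩
  · exact ⟨h1.ge, h2.le⟩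

lemma Step.not_le {c : S.Edge × T.Edge → Prop} {x y : S.Edge × T.Edge} (h : Step c x y) :
    ¬ y ≤ x := by
  rcases h with ⟨-, h1, h2⟩ | ⟨-, h1, h2⟩
  · exact fun h => h1.1.not_ge h.1
  · exact fun h => h2.1.not_ge h.2

lemma Reach.le {c : S.Edge × T.Edge → Prop} {x y : S.Edge × T.Edge} (h : Reach c x y) : x ≤ y := by
  induction h with
  | refl => exact le_rfl
  | tail _ h ih => exact ih.trans h.le

/-- Two steps from the same pair which lead below a common pair agree. -/
lemma Step.unique {c : S.Edge × T.Edge → Prop} {x y y' z : S.Edge × T.Edge} (h : Step c x y)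
    (h' : Step c x y') (hz : y ≤ z) (hz' : y' ≤ z) : y = y' := by
  rcases h with ⟨k, h1, h2⟩ | ⟨k, h1, h2⟩ <;> rcases h' with ⟨k', h1', h2'⟩ | ⟨k', h1', h2'⟩
  · exact Prod.ext (S.eq_of_covBy h1 h1' hz.1 hz'.1) (h2.trans h2'.symm)
  · exact (k' k).elim
  · exact (k k').elim
  · exact Prod.ext (h1.trans h1'.symm) (T.eq_of_covBy h2 h2' hz.2 hz'.2)

lemma Reach.of_le {c : S.Edge × T.Edge → Prop} {r x y : S.Edge × T.Edge} (hx : Reach c r x)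
    (hy : Reach c r y) (h : x ≤ y) : Reach c x y := by
  induction hx using Relation.ReflTransGen.head_induction_on with
  | refl => exact hy
  | head h1 h2 ih =>
    rcases hy.cases_head with rfl | ⟨d, hd, hdy⟩
    · exact (h1.not_le ((Reach.le h2).trans h)).elim
    · obtain rfl := h1.unique hd ((Reach.le h2).trans h) (Reach.le hdy)
      exact ih hdy

lemma Reach.not_cross {c : S.Edge × T.Edge → Prop} {r x y : S.Edge × T.Edge} (hx : Reach c r x)
    (hy : Reach c r y) (h1 : x.1 ≤ y.1) (h2 : y.2 ≤ x.2) : x ≤ y ∨ y ≤ x := by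
  induction hx using Relation.ReflTransGen.head_induction_on with
  | refl => exact Or.inl hy.le
  | @head r d h h' ih =>
    rcases hy.cases_head with rfl | ⟨d', hd, hdy⟩
    · exact Or.inr (h.le.trans (Reach.le h'))
    · have : d = d' := by
        have e1 := Reach.le h'
        have e2 := Reach.le hdy
        rcases h with ⟨k, a1, a2⟩ | ⟨k, a1, a2⟩ <;> rcases hd with ⟨k', b1, b2⟩ | ⟨k', b1, b2⟩
        · exact Prod.ext (S.eq_of_covBy a1 b1 (e1.1.trans h1) e2.1) (a2.trans b2.symm)
        · exact (k' k).elim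
        · exact (k k').elim
        · exact Prod.ext (a1.trans b1.symm) (T.eq_of_covBy a2 b2 e1.2 (e2.2.trans h2))
      subst this
      exact ih hdy

lemma Reach.total_below {c : S.Edge × T.Edge → Prop} {r x y z : S.Edge × T.Edge}
    (hx : Reach c r x) (hy : Reach c r y) (hxz : x ≤ z) (hyz : y ≤ z) : x ≤ y ∨ y ≤ x := by
  rcases S.total_below hxz.1 hyz.1 with h1 | h1 <;> rcases T.total_below hxz.2 hyz.2 with h2 | h2
  · exact Or.inl ⟨h1, h2⟩
  · exact hx.not_cross hy h1 h2
  · exact (hy.not_cross hx h1 h2).symm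
  · exact Or.inr ⟨h1, h2⟩

/-- The pairs reachable from the pair of roots. -/
abbrev Carrier (c : S.Edge × T.Edge → Prop) : Type := {x : S.Edge × T.Edge // Reach c (⊥, ⊥) x}

instance (c : S.Edge × T.Edge → Prop) : OrderBot (Carrier c) where
  bot := ⟨(⊥, ⊥), Relation.ReflTransGen.refl⟩
  bot_le := fun _ => ⟨bot_le, bot_le⟩

lemma covBy_iff {c : S.Edge × T.Edge → Prop} (x y : Carrier c) : x ⋖ y ↔ Step c x.1 y.1 := by
  constructor
  · intro h
    have hr : Reach c x.1 y.1 := Reach.of_le x.2 y.2 h.1.le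
    rcases hr.cases_head with e | ⟨d, hd, hdy⟩
    · exact (h.1.ne (Subtype.ext e)).elim
    · have hdr : Reach c (⊥, ⊥) d := x.2.tail hd
      have h1 : x < ⟨d, hdr⟩ := lt_of_le_not_ge hd.le hd.not_le
      have h2 : (⟨d, hdr⟩ : Carrier c) ≤ y := Reach.le hdy
      rcases h2.lt_or_eq with h2 | h2
      · exact (h.2 h1 h2).elim
      · rw [← h2]
        exact hd
  · intro h
    refine ⟨lt_of_le_not_ge h.le h.not_le, fun z hxz hzy => ?_⟩
    have hr : Reach c x.1 z.1 := Reach.of_le x.2 z.2 hxz.le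
    rcases hr.cases_head with e | ⟨d, hd, hdz⟩
    · exact hxz.ne (Subtype.ext e)
    · have hzy' : z.1 ≤ y.1 := hzy.le
      have hdz' := Reach.le hdz
      have : d = y.1 := hd.unique h (hdz'.trans hzy') le_rfl
      rw [this] at hdz'
      exact hzy.not_ge hdz'

/-- The closed tree of pairs reachable from the pair of roots. -/
abbrev choiceTree (c : S.Edge × T.Edge → Prop) : ClosedTree :=
  ofPoset (Carrier c) fun x y _ h h' => Reach.total_below x.2 y.2 h h'

/-- The identification of the edges of `choiceTree c`. -/
abbrev choiceIso (c : S.Edge × T.Edge → Prop) : (choiceTree c).Edge ≃o Carrier c :=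
  ofPosetIso (Carrier c) fun x y _ h h' => Reach.total_below x.2 y.2 h h'

lemma mem_inputs_iff (c : S.Edge × T.Edge → Prop) (a b : (choiceTree c).Edge) :
    b ∈ (choiceTree c).inputs a ↔ Step c (choiceIso c a).1 (choiceIso c b).1 := by
  rw [← covBy_iff]
  exact (apply_covBy_apply_iff (choiceIso c)).symm

/-- The shuffle which is built up from the root by putting a copy of a vertex of `S` on top of the
edge labelled `x` if `c x` holds, and a copy of a vertex of `T` otherwise. -/
def ofChoice (c : S.Edge × T.Edge → Prop) : Shuffle S T where
  tree := choiceTree c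
  label := fun a => (choiceIso c a).1
  label_root := by rw [map_bot]; rfl
  label_inputs := fun a => by
    have inj : ∀ s : Set (choiceTree c).Edge, s.InjOn fun a => (choiceIso c a).1 :=
      fun s => (Subtype.val_injective.comp (choiceIso c).injective).injOn
    have surj : ∀ x, Step c (choiceIso c a).1 x →
        x ∈ (fun a => (choiceIso c a).1) '' (choiceTree c).inputs a := fun x hx =>
      ⟨(choiceIso c).symm ⟨x, (choiceIso c a).2.tail hx⟩, by rw [mem_inputs_iff]; simpa using hx,
        by simp⟩
    by_cases h : c (choiceIso c a).1
    · left
      refine ⟨fun b hb => ?_, inj _, fun x hx => surj x (Or.inl ⟨h, hx⟩)⟩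
      rcases (mem_inputs_iff c a b).1 hb with h' | h'
      · exact h'.2
      · exact (h'.1 h).elim
    · right
      refine ⟨fun b hb => ?_, inj _, fun x hx => surj x (Or.inr ⟨h, hx⟩)⟩
      rcases (mem_inputs_iff c a b).1 hb with h' | h'
      · exact (h h'.1).elim
      · exact h'.2

/-- A set of pairs without crossings is contained in a shuffle. -/
lemma exists_choice (B : Set (S.Edge × T.Edge))
    (hB : ∀ y ∈ B, ∀ z ∈ B, y.1 < z.1 → ¬ z.2 < y.2) :
    ∃ c : S.Edge × T.Edge → Prop, ∀ y ∈ B, Reach c (⊥, ⊥) y := by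
  refine ⟨fun x => ∀ y ∈ B, x ≤ y → x ≠ y → x.1 < y.1, fun y hy => ?_⟩
  suffices H : ∀ x : S.Edge × T.Edge, x ≤ y →
      Reach (fun x => ∀ y ∈ B, x ≤ y → x ≠ y → x.1 < y.1) x y from H _ ⟨bot_le, bot_le⟩
  intro x
  induction x using WellFoundedGT.induction with
  | ind x ih =>
    intro hxy
    by_cases e : x = y
    · rw [e]
    by_cases hc : ∀ y ∈ B, x ≤ y → x ≠ y → x.1 < y.1
    · obtain ⟨a, ha, hay⟩ := S.exists_covBy_le (hc y hy hxy e)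
      have hs : Step (fun x => ∀ y ∈ B, x ≤ y → x ≠ y → x.1 < y.1) x (a, x.2) :=
        Or.inl ⟨hc, ha, rfl⟩
      exact Relation.ReflTransGen.head hs
        (ih _ (lt_of_le_not_ge hs.le hs.not_le) ⟨hay, hxy.2⟩)
    · have hlt : x.2 < y.2 := by
        obtain ⟨z, hz, hxz, hne, hnlt⟩ : ∃ z ∈ B, x ≤ z ∧ x ≠ z ∧ ¬ x.1 < z.1 := by
          push Not at hc
          exact hc
        have hz1 : x.1 = z.1 := by
          by_contra h
          exact hnlt (hxz.1.lt_of_ne h)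
        have hz2 : x.2 < z.2 := hxz.2.lt_of_ne fun h => hne (Prod.ext hz1 h)
        refine hxy.2.lt_of_ne fun h => ?_
        have h1 : x.1 < y.1 := hxy.1.lt_of_ne fun h' => e (Prod.ext h' h)
        exact hB z hz y hy (hz1 ▸ h1) (h ▸ hz2)
      obtain ⟨a, ha, hay⟩ := T.exists_covBy_le hlt
      have hs : Step (fun x => ∀ y ∈ B, x ≤ y → x ≠ y → x.1 < y.1) x (x.1, a) :=
        Or.inr ⟨hc, rfl, ha⟩
      exact Relation.ReflTransGen.head hs
        (ih _ (lt_of_le_not_ge hs.le hs.not_le) ⟨hxy.1, hay⟩)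

end Shuffle

/-- A criterion for dendrices of `S ⊗ T`, from which the functoriality of `S ⊗ T` is clear. -/
lemma isTensorDendrex_iff {R S T : ClosedTree} (φ : R.Edge → S.Edge × T.Edge) :
    IsTensorDendrex φ ↔ Monotone φ ∧
      ∀ a b, Incomp a b → Incomp (φ a).1 (φ b).1 ∨ Incomp (φ a).2 (φ b).2 := by
  constructor
  · rintro ⟨A, k, h⟩
    refine ⟨fun a b hab => ?_, fun a b hab => ?_⟩
    · rw [h, h]
      exact A.label_mono (onEdges_mono k hab)
    · rw [h, h]
      exact A.label_incomp (onEdges_incomp k hab)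
  · rintro ⟨h1, h2⟩
    obtain ⟨c, hc⟩ := Shuffle.exists_choice (Set.range φ) (by
      rintro _ ⟨a, rfl⟩ _ ⟨b, rfl⟩ h h'
      by_cases hab : a ≤ b
      · exact h'.not_ge (h1 hab).2
      by_cases hba : b ≤ a
      · exact h.not_ge (h1 hba).1
      rcases h2 a b ⟨hab, hba⟩ with k | k
      · exact k.1 h.le
      · exact k.2 h'.le)
    let ψ : R.Edge → Shuffle.Carrier c := fun e => ⟨φ e, hc _ ⟨e, rfl⟩⟩
    refine ⟨Shuffle.ofChoice c, mkHom (fun e => (Shuffle.choiceIso c).symm (ψ e))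
      (fun a b hab => ?_) (fun a b hab => ?_), fun e => ?_⟩
    · exact (Shuffle.choiceIso c).symm.monotone (show ψ a ≤ ψ b from h1 hab)
    · have key : Incomp (ψ a) (ψ b) := by
        rcases h2 a b hab with k | k
        · exact ⟨fun h => k.1 h.1, fun h => k.2 h.1⟩
        · exact ⟨fun h => k.1 h.2, fun h => k.2 h.2⟩
      exact ⟨fun h => key.1 ((Shuffle.choiceIso c).symm.le_iff_le.1 h),
        fun h => key.2 ((Shuffle.choiceIso c).symm.le_iff_le.1 h)⟩
    · exact (congrArg Subtype.val ((Shuffle.choiceIso c).apply_symm_apply (ψ e))).symm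

lemma IsTensorDendrex.precomp {R' R S T : ClosedTree} {φ : R.Edge → S.Edge × T.Edge}
    (h : IsTensorDendrex φ) (r : R' ⟶ R) : IsTensorDendrex (φ ∘ onEdges r) := by
  obtain ⟨A, k, hk⟩ := h
  exact ⟨A, r ≫ k, fun e => hk _⟩

lemma IsTensorDendrex.postcomp {R S T S' T' : ClosedTree} {φ : R.Edge → S.Edge × T.Edge}
    (h : IsTensorDendrex φ) (f : S ⟶ S') (g : T ⟶ T') :
    IsTensorDendrex (Prod.map (onEdges f) (onEdges g) ∘ φ) := by
  rw [isTensorDendrex_iff] at h ⊢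
  refine ⟨fun a b hab => ⟨onEdges_mono f (h.1 hab).1, onEdges_mono g (h.1 hab).2⟩,
    fun a b hab => ?_⟩
  rcases h.2 a b hab with k | k
  · exact Or.inl (onEdges_incomp f k)
  · exact Or.inr (onEdges_incomp g k)

/-! ### Closed dendroidal sets and their tensor product -/

/-- The category of closed dendroidal sets: presheaves of sets on the category of closed trees. -/
abbrev ClosedDendroidalSet : Type 1 := ClosedTreeᵒᵖ ⥤ Type

/-- The set of dendrices of shape `R` of the closed dendroidal set `S ⊗ T`, the union of all the
shuffles of `S` and `T`. -/
abbrev TreeTensor (S T R : ClosedTree) : Type :=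
  {φ : R.Edge → S.Edge × T.Edge // IsTensorDendrex φ}

namespace TreeTensor

/-- The presheaf structure of `S ⊗ T`. -/
def restrict {S T R R' : ClosedTree} (r : R' ⟶ R) (φ : TreeTensor S T R) : TreeTensor S T R' :=
  ⟨φ.1 ∘ onEdges r, φ.2.precomp r⟩

/-- The functoriality of `S ⊗ T` in `S` and `T`. -/
def push {S T S' T' R : ClosedTree} (f : S ⟶ S') (g : T ⟶ T') (φ : TreeTensor S T R) :
    TreeTensor S' T' R :=
  ⟨Prod.map (onEdges f) (onEdges g) ∘ φ.1, φ.2.postcomp f g⟩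

end TreeTensor

section Tensor

open Opposite

/-- The elements from which `(X ⊗ Y)_R` is built: a dendrex `x` of `X` of shape `S`, a dendrex `y`
of `Y` of shape `T`, and a dendrex of `S ⊗ T` of shape `R`. -/
structure PreTensor (X Y : ClosedDendroidalSet) (R : ClosedTree) where
  S : ClosedTree
  T : ClosedTree
  x : X.obj (op S)
  y : Y.obj (op T)
  φ : TreeTensor S T R

/-- The identifications in `(X ⊗ Y)_R`: for `f : S ⟶ S'`, `g : T ⟶ T'`, `x'` in `X_{S'}`, `y'` in
`Y_{T'}` and `φ` in `(S ⊗ T)_R`, the triple `(f^* x', g^* y', φ)` is identified with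
`(x', y', (f ⊗ g) φ)`. -/
inductive PreTensor.Rel (X Y : ClosedDendroidalSet) (R : ClosedTree) :
    PreTensor X Y R → PreTensor X Y R → Prop
  | mk {S S' T T' : ClosedTree} (f : S ⟶ S') (g : T ⟶ T') (x' : X.obj (op S')) (y' : Y.obj (op T'))
      (φ : TreeTensor S T R) :
      PreTensor.Rel X Y R ⟨S, T, X.map f.op x', Y.map g.op y', φ⟩
        ⟨S', T', x', y', TreeTensor.push f g φ⟩

/-- The tensor product `X ⊗ Y` of closed dendroidal sets, i.e. the extension of the tensor product
of closed trees which preserves colimits in each variable: the colimit of the `S ⊗ T` over all maps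
`S → X` and `T → Y` from representables, or equivalently the coend
`∫^{S,T} X_S × Y_T × (S ⊗ T)`. -/
def tensorObj (X Y : ClosedDendroidalSet) : ClosedDendroidalSet where
  obj R := Quot (PreTensor.Rel X Y R.unop)
  map r := TypeCat.ofHom (Quot.map (fun p => ⟨p.S, p.T, p.x, p.y, p.φ.restrict r.unop⟩) (by
    rintro _ _ ⟨f, g, x', y', φ⟩
    exact PreTensor.Rel.mk f g x' y' (φ.restrict r.unop)))
  map_id R := by
    ext ⟨p⟩
    rfl
  map_comp r r' := by
    ext ⟨p⟩
    rfl

/-- The functoriality of the tensor product in both variables. -/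
def tensorMap {X X' Y Y' : ClosedDendroidalSet} (i : X ⟶ X') (j : Y ⟶ Y') :
    tensorObj X Y ⟶ tensorObj X' Y' where
  app R := TypeCat.ofHom (Quot.map (fun p => ⟨p.S, p.T, i.app _ p.x, j.app _ p.y, p.φ⟩) (by
    rintro _ _ ⟨f, g, x', y', φ⟩
    have h1 := NatTrans.naturality_apply i f.op x'
    have h2 := NatTrans.naturality_apply j g.op y'
    dsimp only
    rw [h1, h2]
    exact PreTensor.Rel.mk f g _ _ φ))
  naturality R R' r := by
    ext ⟨p⟩
    rfl

/-- The tensor product of closed dendroidal sets as a functor of two variables. -/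
def tensor : ClosedDendroidalSet ⥤ ClosedDendroidalSet ⥤ ClosedDendroidalSet where
  obj X :=
    { obj := fun Y => tensorObj X Y
      map := fun j => tensorMap (𝟙 X) j
      map_id := fun Y => by ext R ⟨p⟩; rfl
      map_comp := fun j j' => by ext R ⟨p⟩; rfl }
  map i :=
    { app := fun Y => tensorMap i (𝟙 Y)
      naturality := fun Y Y' j => by ext R ⟨p⟩; rfl }
  map_id X := by ext Y R ⟨p⟩; rfl
  map_comp i i' := by ext Y R ⟨p⟩; rfl

/-- The pushout-product map `U ⊗ Y ∪ X ⊗ V ⟶ X ⊗ Y` of `i : U ⟶ X` and `j : V ⟶ Y`, where the union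
denotes the pushout under `U ⊗ V`. -/
def pushoutProduct {U X V Y : ClosedDendroidalSet} (i : U ⟶ X) (j : V ⟶ Y) :
    Limits.pushout ((tensor.obj U).map j) ((tensor.map i).app V) ⟶ (tensor.obj X).obj Y :=
  Limits.pushout.desc ((tensor.map i).app Y) ((tensor.obj X).map j) ((tensor.map i).naturality j)

/-! ### Normal monomorphisms and very inner anodyne morphisms -/

/-- A monomorphism `X ⟶ Y` of closed dendroidal sets is normal if, for every closed tree `T`, the
group of automorphisms of `T` acts freely on the complement of the image of `X_T` in `Y_T`. -/
def IsNormalMono {X Y : ClosedDendroidalSet} (f : X ⟶ Y) : Prop :=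
  Mono f ∧ ∀ (T : ClosedTree) (σ : Aut T) (y : Y.obj (op T)),
    y ∉ Set.range (f.app (op T)) → Y.map σ.hom.op y = y → σ = 1

/-- The horn `Λ_cl^e T` of a closed tree `T`: the union, in the representable presheaf of `T`, of
all the closed faces of `T` except the one contracting `e`. -/
def horn (T : ClosedTree) (e : T.Edge) : Subfunctor (yoneda.obj T) where
  obj R := {f | ∃ (d : T.Edge) (F : ClosedTree) (δ : F ⟶ T) (k : R.unop ⟶ F),
    d ≠ e ∧ IsFace δ d ∧ f = k ≫ δ}
  map r f := by
    rintro ⟨d, F, δ, k, hd, hδ, rfl⟩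
    exact ⟨d, F, δ, r.unop ≫ k, hd, hδ, by simp⟩

/-- The set of the very inner horn inclusions `Λ_cl^e T ⟶ T`, for all closed trees `T` and all very
inner edges `e` of `T`. -/
def veryInnerHornInclusions : MorphismProperty ClosedDendroidalSet :=
  MorphismProperty.ofHoms
    fun p : Σ T : ClosedTree, {e : T.Edge // T.IsVeryInner e} => (horn p.1 p.2.1).ι

/-- A class of morphisms is saturated if it is closed under pushouts, transfinite compositions and
retracts. -/
structure IsSaturated (W : MorphismProperty ClosedDendroidalSet) : Prop where
  pushouts : W.IsStableUnderCobaseChange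
  transfinite : MorphismProperty.IsStableUnderTransfiniteComposition.{0} W
  retracts : W.IsStableUnderRetracts

/-- Very inner anodyne (via) morphisms: those in the saturation of the set of very inner horn
inclusions, i.e. in every saturated class which contains the very inner horn inclusions. -/
def IsVeryInnerAnodyne {X Y : ClosedDendroidalSet} (f : X ⟶ Y) : Prop :=
  ∀ W : MorphismProperty ClosedDendroidalSet, IsSaturated W → veryInnerHornInclusions ≤ W → W f

end Tensor

end Dendroidal

end

/-! By the small object argument, every saturated class containing the very inner horn inclusions
contains each morphism that lifts against all `p` having the right lifting property against these
horns (`isVeryInnerAnodyne_of_llp`). So it suffices to lift the pushout-product against such `p`.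
The tensor product is symmetric and a left adjoint in two variables, so this lifting problem can be
moved onto either factor, against a pullback-hom. Via morphisms lift as soon as very inner horns do,
and normal monomorphisms as soon as boundaries do. What remains is the pushout-product of `∂S → S`
and `Λ^e T → T`.

For closed trees, morphisms are the maps on edges preserving order and incomparability, and `S ⊗ T`
is a presheaf of labellings by pairs. Up to isomorphism its nondegenerate dendrices are certain sets
`B` of pairs (`IsTreeSet`). The pushout-product becomes the inclusion of those dendrices whose set
of labels is not full, i.e. misses an edge of `S` or an edge of `T` other than `e`.

The combinatorial core is a pairing of the full tree sets. As `e` is very inner, a full `B` contains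
pairs `(s, t)` with `e < t`; let `s` be the first edge so occurring, in a fixed linear extension of
the order of `S`. Then `B ∪ {(s, e)}` is again a tree set (`IsTreeSet.insert`), and adding or
removing `(s, e)` does not change `s`. So the missing sets come in pairs `D ∖ {(s, e)}`, `D`, and
both are added by filling the horn of `D` at its very inner edge `(s, e)`. If `D` is chosen of least
size, and then with `s` as late as possible, all other faces are already present
(`exists_minimal_face`). A Zorn argument (`hasLiftingProperty_of_cells`) assembles these steps into
a lift. -/

noncomputable section

namespace Dendroidal

open Limits MorphismProperty

/-! ### Coproducts as transfinite compositions -/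

section Coproducts

variable {C : Type*} [Category C]

/-- A coproduct of morphisms, all of which but one are isomorphisms, is a pushout of the
remaining one. -/
lemma isPushout_sigmaMap {I : Type*} {X Y : I → C} [HasCoproduct X] [HasCoproduct Y]
    (α : ∀ i, X i ⟶ Y i) (a : I) (hα : ∀ i, i ≠ a → IsIso (α i)) :
    IsPushout (Sigma.ι X a) (α a) (Limits.Sigma.map α) (Sigma.ι Y a) := by
  classical
  refine ⟨⟨by simp⟩, ⟨PushoutCocone.IsColimit.mk _ (fun s => Limits.Sigma.desc fun i =>
    if h : i = a then eqToHom (by rw [h]) ≫ s.inr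
    else (have := hα i h; inv (α i) ≫ Sigma.ι X i ≫ s.inl)) (fun s => ?_) (fun s => ?_)
    (fun s m h1 h2 => ?_)⟩⟩
  · refine Limits.Sigma.hom_ext _ _ fun i => ?_
    by_cases h : i = a
    · subst h
      simpa using s.condition.symm
    · simp [h]
  · simp
  · refine Limits.Sigma.hom_ext _ _ fun i => ?_
    by_cases h : i = a
    · subst h
      simpa using h2
    · have := hα i h
      simp [h, ← h1]

/-- Let `F` be the coproduct of the functors `G i`. A cocone on `F` is a colimit cocone if it is the
coproduct of colimit cocones on the functors `G i`. -/
def isColimitOfCofan {I K : Type*} [Category K] {F : K ⥤ C} {G : I → K ⥤ C} (ι : ∀ i, G i ⟶ F)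
    (hι : ∀ k, IsColimit (Cofan.mk (F.obj k) fun i => (ι i).app k)) {c : Cocone F}
    {c' : ∀ i, Cocone (G i)} (hc' : ∀ i, IsColimit (c' i)) (κ : ∀ i, (c' i).pt ⟶ c.pt)
    (hκ : IsColimit (Cofan.mk c.pt κ))
    (comm : ∀ i k, (c' i).ι.app k ≫ κ i = (ι i).app k ≫ c.ι.app k) : IsColimit c where
  desc s := Cofan.IsColimit.desc hκ fun i => (hc' i).desc ⟨s.pt, ι i ≫ s.ι⟩
  fac s k := by
    refine Cofan.IsColimit.hom_ext (hι k) _ _ fun i => ?_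
    have h1 := Cofan.IsColimit.fac hκ (fun i => (hc' i).desc ⟨s.pt, ι i ≫ s.ι⟩) i
    have h2 := (hc' i).fac ⟨s.pt, ι i ≫ s.ι⟩ k
    dsimp at h1 h2 ⊢
    rw [← reassoc_of% (comm i k), h1, h2]
  uniq s m h := by
    refine Cofan.IsColimit.hom_ext hκ _ _ fun i => ?_
    rw [Cofan.IsColimit.fac]
    refine (hc' i).uniq ⟨s.pt, ι i ≫ s.ι⟩ _ fun k => ?_
    have := comm i k
    dsimp at this ⊢
    rw [reassoc_of% this, h]

/-- The coproduct of a family of functors. -/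
def sigmaFunctor {I : Type} {K : Type*} [Category K] [HasCoproducts.{0} C] (G : I → K ⥤ C) :
    K ⥤ C where
  obj k := ∐ fun i => (G i).obj k
  map φ := Limits.Sigma.map fun i => (G i).map φ

variable {I : Type} {A B : I → C} (f : ∀ i, A i ⟶ B i)

section

variable [LinearOrder I]

open Classical in
/-- The indicator function of the elements after `i`. -/
def jump (i : I) : WithTop I →o Fin 2 where
  toFun j := if (i : WithTop I) < j then 1 else 0
  monotone' j k hjk := by
    dsimp only
    by_cases h : (i : WithTop I) < j
    · simp [h, h.trans_le hjk]
    · simp [h]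

lemma jump_eq_one {i : I} {j : WithTop I} (h : (i : WithTop I) < j) : jump i j = 1 := if_pos h

lemma jump_eq_zero {i : I} {j : WithTop I} (h : ¬ (i : WithTop I) < j) : jump i j = 0 := if_neg h

/-- The functor on a linearly ordered set with a top element added which takes the value `A i` up to
`i`, and the value `B i` after `i`. -/
def jumpFunctor (i : I) : WithTop I ⥤ C :=
  (jump i).monotone.functor ⋙ ComposableArrows.mk₁ (f i)

/-- The jump function has the same value at both ends unless the map crosses `i`. -/
lemma jumpFunctor_isIso {i : I} {j k : WithTop I} (hjk : j ⟶ k)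
    (h : (i : WithTop I) < k → (i : WithTop I) < j) : IsIso ((jumpFunctor f i).map hjk) := by
  have e : jump i j = jump i k := by
    by_cases h' : (i : WithTop I) < k
    · rw [jump_eq_one h', jump_eq_one (h h')]
    · rw [jump_eq_zero h', jump_eq_zero fun h'' => h' (h''.trans_le (leOfHom hjk))]
  have : IsIso (homOfLE e.le) := by
    rw [show homOfLE e.le = (eqToIso e).hom from Subsingleton.elim _ _]
    infer_instance
  exact inferInstanceAs (IsIso ((ComposableArrows.mk₁ (f i)).map (homOfLE e.le)))

/-- The value of `jumpFunctor` on a map which crosses the jump. -/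
def jumpFunctorIso {i : I} {j k : WithTop I} (hjk : j ⟶ k)
    (h : ¬ (i : WithTop I) < j) (h' : (i : WithTop I) < k) :
    CategoryTheory.Arrow.mk ((jumpFunctor f i).map hjk) ≅ CategoryTheory.Arrow.mk (f i) := by
  let G := ComposableArrows.mk₁ (f i)
  have comm (a : jump i j ⟶ 0) (b : 0 ⟶ 1) (c : jump i j ⟶ jump i k) (d : jump i k ⟶ 1) :
      G.map a ≫ G.map b = G.map c ≫ G.map d := by
    rw [← Functor.map_comp, ← Functor.map_comp]
    rfl
  exact CategoryTheory.Arrow.isoMk (G.mapIso (eqToIso (jump_eq_zero h)))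
    (G.mapIso (eqToIso (jump_eq_one h'))) (comm (eqToHom (jump_eq_zero h))
      (homOfLE (by decide)) (homOfLE ((jump i).monotone (leOfHom hjk)))
      (eqToHom (jump_eq_one h')))

variable [WellFoundedLT I] [SuccOrder (WithTop I)] [OrderBot (WithTop I)]

instance (i : I) : (jumpFunctor f i).IsWellOrderContinuous where
  nonempty_isColimit m hm := by
    have : Nonempty (Set.Iio m) := ⟨⟨⊥, hm.bot_lt⟩⟩
    -- Below a limit `m` the functor is constant from the successor of `i` on if `i < m`, and
    -- constant throughout otherwise.
    let k : Set.Iio m := if h : (i : WithTop I) < m then ⟨Order.succ i, hm.succ_lt h⟩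
      else ⟨⊥, hm.bot_lt⟩
    have hk : ∀ l : WithTop I, l ≤ m → (i : WithTop I) < l → (i : WithTop I) < k.1 := by
      intro l hl hil
      have h : (i : WithTop I) < m := hil.trans_le hl
      simp only [k, dif_pos h]
      exact Order.lt_succ_of_not_isMax (not_isMax_of_lt h)
    have h1 : ((Set.principalSegIio m).monotone.functor ⋙
        jumpFunctor f i).IsEventuallyConstantFrom k := fun l hl =>
      jumpFunctor_isIso f (homOfLE (show k.1 ≤ l.1 from leOfHom hl)) (hk l.1 l.2.le)
    have : IsIso (((Set.principalSegIio m).cocone (jumpFunctor f i)).ι.app k) :=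
      jumpFunctor_isIso f (homOfLE k.2.le) (hk m le_rfl)
    exact ⟨h1.isColimitOfIsIso _⟩

variable [HasCoproducts.{0} C]

/-- Coproducts commute with colimits, so continuity is inherited from the summands. -/
instance : (sigmaFunctor (jumpFunctor f)).IsWellOrderContinuous where
  nonempty_isColimit m hm := ⟨isColimitOfCofan
    (F := (Set.principalSegIio m).monotone.functor ⋙ sigmaFunctor (jumpFunctor f))
    (G := fun i => (Set.principalSegIio m).monotone.functor ⋙ jumpFunctor f i)
    (fun i => { app j := Sigma.ι (fun i => (jumpFunctor f i).obj j.1) i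
                naturality j k φ := (Sigma.ι_map (fun i => (jumpFunctor f i).map
                  (homOfLE (show j.1 ≤ k.1 from leOfHom φ))) i).symm })
    (fun _ => coproductIsCoproduct _)
    (fun i => (jumpFunctor f i).isColimitOfIsWellOrderContinuous m hm)
    (fun i => Sigma.ι (fun i => (jumpFunctor f i).obj m) i) (coproductIsCoproduct _)
    (fun i k => (Sigma.ι_map (fun i => (jumpFunctor f i).map (homOfLE k.2.le)) i).symm)⟩

end

/-- A class of morphisms which is stable under cobase change and transfinite composition is stable
under coproducts. -/
lemma isStableUnderCoproducts_of_transfinite [HasCoproducts.{0} C] (W : MorphismProperty C)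
    [W.IsStableUnderCobaseChange] [IsStableUnderTransfiniteComposition.{0} W] :
    IsStableUnderCoproducts.{0} W where
  isStableUnderCoproductsOfShape I := by
    refine IsStableUnderCoproductsOfShape.mk _ _ fun A B _ _ f hf => ?_
    obtain ⟨_, _⟩ := exists_wellFoundedLT I
    let : SuccOrder (WithTop I) := .ofLinearWellFoundedLT _
    let : OrderBot (WithTop I) := WellFoundedLT.toOrderBot _
    let F := sigmaFunctor (jumpFunctor f)
    -- The step from `a` to its successor only replaces the summand `A a` by `B a`, hence is a
    -- pushout of `f a`; the composite of all steps is the coproduct of the `f i`.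
    have key : W (F.map (homOfLE bot_le : (⊥ : WithTop I) ⟶ ⊤)) := by
      refine W.transfiniteCompositionsOfShape_le (WithTop I) _ ⟨
        { F := F
          isoBot := Iso.refl _
          incl := (coconeOfDiagramTerminal isTerminalTop F).ι
          isColimit := colimitOfDiagramTerminal isTerminalTop F
          fac := by simp; rfl
          map_mem := fun j hj => ?_ }⟩
      obtain ⟨a, rfl⟩ : ∃ a : I, (a : WithTop I) = j :=
        WithTop.ne_top_iff_exists.1 fun h => hj (h ▸ isMax_top)
      refine W.of_isPushout (isPushout_sigmaMap (fun i => (jumpFunctor f i).map _) a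
        fun i hi => ?_)
        ((W.arrow_mk_iso_iff (jumpFunctorIso f _ (lt_irrefl _)
          (Order.lt_succ_of_not_isMax hj))).2 (hf a))
      refine jumpFunctor_isIso f _ fun h => ?_
      have := (Order.lt_succ_iff_of_not_isMax hj).1 h
      exact this.lt_of_ne fun h => hi (WithTop.coe_injective h)
    refine (W.arrow_mk_iso_iff ?_).1 key
    let e (i : I) : CategoryTheory.Arrow.mk ((jumpFunctor f i).map (homOfLE bot_le : (⊥ : WithTop I) ⟶ ⊤)) ≅
        CategoryTheory.Arrow.mk (f i) :=
      jumpFunctorIso f _ not_lt_bot (WithTop.coe_lt_top i)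
    let l (i : I) : (jumpFunctor f i).obj ⊥ ≅ A i := Arrow.leftFunc.mapIso (e i)
    let r (i : I) : (jumpFunctor f i).obj ⊤ ≅ B i := Arrow.rightFunc.mapIso (e i)
    have comm (i : I) : (l i).hom ≫ f i = (jumpFunctor f i).map (homOfLE bot_le) ≫ (r i).hom :=
      (e i).hom.w
    have h : (Limits.Sigma.mapIso l).hom ≫ Limits.Sigma.map f = Limits.Sigma.map
        (fun i => (jumpFunctor f i).map (homOfLE bot_le)) ≫ (Limits.Sigma.mapIso r).hom := by
      refine Limits.Sigma.hom_ext _ _ fun i => ?_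
      rw [Sigma.ι_mapIso_hom_assoc, Sigma.ι_map, Sigma.ι_map_assoc, Sigma.ι_mapIso_hom,
        reassoc_of% comm i]
    exact CategoryTheory.Arrow.isoMk (Limits.Sigma.mapIso l) (Limits.Sigma.mapIso r) h

end Coproducts

/-! ### The small object argument -/

section SmallObject

open SmallObject

/-- In a locally presentable category, every small family of morphisms permits the small object
argument. -/
lemma hasSmallObjectArgument_ofHoms {C : Type*} [Category.{0} C] [IsLocallyPresentable.{0} C]
    {ι : Type} {A B : ι → C} (f : ∀ i, A i ⟶ B i) : HasSmallObjectArgument.{0} (ofHoms f) := by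
  have key (i : ι) : ∃ (κ : Cardinal.{0}) (_ : Fact κ.IsRegular), IsCardinalPresentable (A i) κ :=
    (inferInstance : IsPresentable.{0} (A i)).exists_cardinal
  choose c hc hA using key
  -- As the family is small, one regular cardinal serves for the presentability of all the sources.
  obtain ⟨κ, hκ, h⟩ := HasCardinalLT.exists_regular_cardinal_forall.{0} fun i => (c i).out
  have : Fact κ.IsRegular := ⟨hκ⟩
  have : Nonempty κ.ord.ToType := by simpa using hκ.ne_zero
  let := WellFoundedLT.toOrderBot κ.ord.ToType
  have : HasColimitsOfSize.{0, 0} C := by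
    obtain ⟨κ', _, _⟩ := IsLocallyPresentable.exists_cardinal.{0} C
    infer_instance
  refine ⟨κ, inferInstance, inferInstance,
    { isSmall := isSmall_ofHoms _
      preservesColimit := fun {A' B' X Y} i hi g hg => ?_ }⟩
  obtain ⟨a⟩ := hi
  have : IsCardinalPresentable (A a) κ := by
    refine isCardinalPresentable_of_le (A a) (κ := c a) ?_
    simpa [hasCardinalLT_iff_cardinal_mk_lt] using (h a).le
  have := preservesColimitsOfShape_of_isCardinalPresentable (A a) κ κ.ord.ToType
  infer_instance

end SmallObject

/-- Saturated classes containing the very inner horn inclusions contain all morphisms with the left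
lifting property against the morphisms with the right lifting property against these inclusions. -/
lemma isVeryInnerAnodyne_of_llp {X Y : ClosedDendroidalSet} {f : X ⟶ Y}
    (hf : veryInnerHornInclusions.rlp.llp f) : IsVeryInnerAnodyne f := by
  intro W hW hJ
  have := hW.pushouts
  have := hW.transfinite
  have := hW.retracts
  -- The small object argument attaches coproducts of horns at each stage, and closure under
  -- coproducts is not among the axioms of a saturated class.
  have := isStableUnderCoproducts_of_transfinite W
  have : HasSmallObjectArgument.{0} veryInnerHornInclusions := hasSmallObjectArgument_ofHoms _
  rw [llp_rlp_of_hasSmallObjectArgument.{0}] at hf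
  refine (?_ : _ ≤ W) _ hf
  rw [retracts_le_iff, transfiniteCompositions_le_iff, pushouts_le_iff, coproducts_le_iff]
  exact hJ

lemma isSaturated_llp (W : MorphismProperty ClosedDendroidalSet) : IsSaturated W.llp :=
  ⟨inferInstance, inferInstance, inferInstance⟩

open Opposite ClosedTree

/-! ### The tensor product as a left adjoint in two variables -/

/-- The element of `(X ⊗ Y)_R` given by `x ∈ X_S`, `y ∈ Y_T` and `φ ∈ (S ⊗ T)_R`. -/
def tensorMk {X Y : ClosedDendroidalSet} {S T R : ClosedTree} (x : X.obj (op S)) (y : Y.obj (op T))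
    (φ : TreeTensor S T R) : (tensorObj X Y).obj (op R) :=
  Quot.mk _ ⟨S, T, x, y, φ⟩

lemma tensorMk_map {X Y : ClosedDendroidalSet} {S T S' T' R : ClosedTree} (f : S ⟶ S') (g : T ⟶ T')
    (x : X.obj (op S')) (y : Y.obj (op T')) (φ : TreeTensor S T R) :
    tensorMk (X.map f.op x) (Y.map g.op y) φ = tensorMk x y (φ.push f g) :=
  Quot.sound (PreTensor.Rel.mk f g x y φ)

/-- The right adjoint of the tensor product, `T ↦ Hom(X ⊗ T, Z)`. -/
def tensorHom : ClosedDendroidalSetᵒᵖ ⥤ ClosedDendroidalSet ⥤ ClosedDendroidalSet where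
  obj X :=
    { obj Z := (yoneda ⋙ tensor.obj X.unop).op ⋙ yoneda.obj Z
      map p := Functor.whiskerLeft _ (yoneda.map p) }
  map f :=
    { app Z := Functor.whiskerRight (NatTrans.op (Functor.whiskerLeft yoneda (tensor.map f.unop)))
        (yoneda.obj Z) }

/-- Naturality of `G` moves a restriction `g` from `y` into the representable factor. This makes the
map built from `G` well defined and shows that it corresponds to `G`. -/
lemma tensorHom_app_map {X Y Z : ClosedDendroidalSet} (G : Y ⟶ (tensorHom.obj (op X)).obj Z)
    {S T T' R : ClosedTree} (g : T ⟶ T') (y : Y.obj (op T')) (x : X.obj (op S))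
    (φ : TreeTensor S T R) :
    (show (tensor.obj X).obj (yoneda.obj T) ⟶ Z from G.app (op T) (Y.map g.op y)).app (op R)
      (tensorMk (Y := yoneda.obj T) x (𝟙 T) φ) =
    (show (tensor.obj X).obj (yoneda.obj T') ⟶ Z from G.app (op T') y).app (op R)
      (tensorMk (Y := yoneda.obj T') x g φ) := by
  rw [show G.app (op T) (Y.map g.op y) = ((tensorHom.obj (op X)).obj Z).map g.op (G.app (op T') y)
    from NatTrans.naturality_apply G g.op y]
  change (show (tensor.obj X).obj (yoneda.obj T') ⟶ Z from G.app (op T') y).app (op R)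
      (tensorMk (Y := yoneda.obj T') x (𝟙 T ≫ g) φ) = _
  rw [Category.id_comp]

/-- The tensor product with `X` is left adjoint to `tensorHom` from `X`. -/
def tensorHomEquiv (X Y Z : ClosedDendroidalSet) :
    ((tensor.obj X).obj Y ⟶ Z) ≃ (Y ⟶ (tensorHom.obj (op X)).obj Z) where
  toFun F :=
    { app T := TypeCat.ofHom fun y => (tensor.obj X).map (yonedaEquiv.symm y) ≫ F
      naturality T T' t := by
        ext y
        change (tensor.obj X).map (yonedaEquiv.symm (Y.map t.unop.op y)) ≫ F =
          (tensor.obj X).map (yoneda.map t.unop) ≫ (tensor.obj X).map (yonedaEquiv.symm y) ≫ F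
        rw [← Functor.map_comp_assoc]
        congr 2
        exact (yonedaEquiv_symm_naturality_left t.unop Y y).symm }
  invFun G :=
    { app R := TypeCat.ofHom (Quot.lift
        (fun p => (show (tensor.obj X).obj (yoneda.obj p.T) ⟶ Z from G.app _ p.y).app R
          (tensorMk (Y := yoneda.obj p.T) p.x (𝟙 p.T) p.φ)) (by
          rintro _ _ ⟨f, g, x', y', φ⟩
          refine (tensorHom_app_map G g y' (X.map f.op x') φ).trans (congrArg _ ?_)
          have := tensorMk_map (Y := yoneda.obj _) f g x' (𝟙 _) φ
          rwa [show (yoneda.obj _).map g.op (𝟙 _) = g from Category.comp_id g] at this))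
      naturality R R' r := by
        ext ⟨p⟩
        exact NatTrans.naturality_apply
          (show (tensor.obj X).obj (yoneda.obj p.T) ⟶ Z from G.app _ p.y) r
          (tensorMk (Y := yoneda.obj p.T) p.x (𝟙 p.T) p.φ) }
  left_inv F := by
    ext R ⟨p⟩
    change F.app R (tensorMk p.x (Y.map (𝟙 p.T).op p.y) p.φ) = F.app R (tensorMk p.x p.y p.φ)
    simp
  right_inv G := by
    ext T y
    refine NatTrans.ext (funext fun R => ?_)
    ext ⟨p⟩
    exact tensorHom_app_map G p.y y p.x p.φ

/-- The tensor product is a left adjoint in two variables. -/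
def tensorAdjunction : tensor ⊣₂ tensorHom :=
  ParametrizedAdjunction.mk'
    (fun X => Adjunction.mkOfHomEquiv
      { homEquiv := tensorHomEquiv X
        homEquiv_naturality_left_symm := fun f G => by
          ext R ⟨p⟩
          rfl
        homEquiv_naturality_right := fun F p => rfl })
    (fun {X₁ Y₁} f _ _ g => by
      rw [Adjunction.mkOfHomEquiv_homEquiv, Adjunction.mkOfHomEquiv_homEquiv]
      ext T y
      change (tensor.obj X₁).map (yonedaEquiv.symm y) ≫ (tensor.map f).app _ ≫ g =
        (tensor.map f).app _ ≫ (tensor.obj Y₁).map (yonedaEquiv.symm y) ≫ g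
      rw [NatTrans.naturality_assoc])

/-- Exchanging the two factors of a tensor product of trees. -/
def TreeTensor.swap {S T R : ClosedTree} (φ : TreeTensor S T R) : TreeTensor T S R :=
  ⟨Prod.swap ∘ φ.1, by
    have h := (isTensorDendrex_iff _).1 φ.2
    exact (isTensorDendrex_iff _).2 ⟨fun a b hab => ⟨(h.1 hab).2, (h.1 hab).1⟩,
      fun a b hab => (h.2 a b hab).symm⟩⟩

/-- One half of the symmetry of the tensor product. -/
def tensorSwap (X Y : ClosedDendroidalSet) : tensorObj X Y ⟶ tensorObj Y X where
  app R := TypeCat.ofHom (Quot.map (fun p => ⟨p.T, p.S, p.y, p.x, p.φ.swap⟩) (by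
    rintro _ _ ⟨f, g, x', y', φ⟩
    exact PreTensor.Rel.mk g f y' x' φ.swap))
  naturality R R' r := by
    ext ⟨p⟩
    rfl

/-- The tensor product is symmetric. -/
def tensorSymmetry : tensor.flip ≅ tensor :=
  NatIso.ofComponents (fun Y => NatIso.ofComponents (fun X =>
    { hom := tensorSwap X Y
      inv := tensorSwap Y X
      hom_inv_id := by ext R ⟨p⟩; rfl
      inv_hom_id := by ext R ⟨p⟩; rfl }) (fun f => by ext R ⟨p⟩; rfl))
    (fun f => by ext X R ⟨p⟩; rfl)

section

variable {U X V Y : ClosedDendroidalSet} (i : U ⟶ X) (j : V ⟶ Y)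

/-- The pushout-product as an instance of the Leibniz construction. -/
def pushoutProductObjObj : tensor.PushoutObjObj i j where
  pt := pushout ((tensor.obj U).map j) ((tensor.map i).app V)
  inl := pushout.inr _ _
  inr := pushout.inl _ _
  isPushout := (IsPushout.of_hasPushout _ _).flip
  ι := pushoutProduct i j
  inl_ι := pushout.inr_desc ..
  inr_ι := pushout.inl_desc ..

/-- The pullback-hom of two morphisms. -/
def pullbackHom {E B : ClosedDendroidalSet} (i : U ⟶ X) (p : E ⟶ B) :=
  (Functor.PullbackObjObj.ofHasPullback tensorHom i p).π

variable {E B : ClosedDendroidalSet} (p : E ⟶ B)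

lemma pushoutProduct_lift_iff :
    HasLiftingProperty (pushoutProduct i j) p ↔ HasLiftingProperty j (pullbackHom i p) :=
  tensorAdjunction.hasLiftingProperty_iff (pushoutProductObjObj i j) _

/-- The flipped pushout square, transported along the symmetry, is a pushout-product square for `j`
and `i`, so the same adjunction applies to it. -/
lemma pushoutProduct_lift_comm :
    HasLiftingProperty (pushoutProduct i j) p ↔ HasLiftingProperty (pushoutProduct j i) p := by
  let sq := (pushoutProductObjObj i j).flip.ofNatIso tensorSymmetry
  rw [pushoutProduct_lift_iff j i, pullbackHom, ← tensorAdjunction.hasLiftingProperty_iff sq]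
  exact HasLiftingProperty.iff_of_arrow_iso_left
    (show CategoryTheory.Arrow.mk (pushoutProduct i j) ≅ CategoryTheory.Arrow.mk sq.ι from
      CategoryTheory.Arrow.isoMk (Iso.refl _) ((tensorSymmetry.app Y).app X) (Category.id_comp _)) p

lemma pushoutProduct_lift_iff' :
    HasLiftingProperty (pushoutProduct i j) p ↔ HasLiftingProperty i (pullbackHom j p) := by
  rw [pushoutProduct_lift_comm, pushoutProduct_lift_iff]

end

/-! ### Lifting properties of inclusions of subfunctors built from cells -/

section Cells

variable {X E B : ClosedDendroidalSet}

/-- A functional relation between presheaves defines a map. -/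
lemma exists_hom_of_functional (Γ : Subfunctor (FunctorToTypes.prod X E))
    (hΓ : ∀ R x e e', (x, e) ∈ Γ.obj R → (x, e') ∈ Γ.obj R → e = e')
    {K : ClosedDendroidalSet} (k : K ⟶ X)
    (hk : ∀ R y, k.app R y ∈ (Γ.image FunctorToTypes.prod.fst).obj R) :
    ∃ g : K ⟶ E, ∀ R y, (k.app R y, g.app R y) ∈ Γ.obj R := by
  have key R y : ∃ e, (k.app R y, e) ∈ Γ.obj R := by
    obtain ⟨⟨x, e⟩, h, h'⟩ := hk R y
    exact ⟨e, by rwa [← h']⟩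
  choose g hg using key
  refine ⟨{ app R := TypeCat.ofHom (g R), naturality R R' r := ?_ }, hg⟩
  ext y
  refine hΓ R' _ _ _ (hg R' (K.map r y)) ?_
  rw [NatTrans.naturality_apply]
  exact Γ.map r (hg R y)

/-- A dendrex `x` is injective relative to a subfunctor `Z` if distinct restrictions of `x` which
are not in `Z` have distinct values. -/
def InjectiveRel (Z : Subfunctor X) {S : ClosedTree} (x : X.obj (op S)) : Prop :=
  ∀ (R : ClosedTree) (f f' : R ⟶ S), X.map f.op x = X.map f'.op x →
    X.map f.op x ∉ Z.obj (op R) → f = f'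

/-- The part of a representable presheaf which a dendrex `x` sends to the subfunctor `Z`. -/
abbrev cellBoundary (Z : Subfunctor X) {S : ClosedTree} (x : X.obj (op S)) :
    Subfunctor (yoneda.obj S) :=
  Z.preimage (yonedaEquiv.symm x)

/-- Partial lifts are taken to be functional relations in `X × E`, so that Zorn's lemma applies to
plain unions. A maximal one with domain `Z ≠ ⊤` would extend over the cell `x`: the lift on `S`
agrees with the old values on `Z`, and outside `Z` it is well defined by relative injectivity. `Q`
is an invariant of the domains, which may be used in choosing the next cell. -/
lemma hasLiftingProperty_of_cells {U : Subfunctor X} {p : E ⟶ B} (Q : Subfunctor X → Prop)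
    (hU : Q U)
    (hQ : ∀ c : Set (Subfunctor X), IsChain (· ≤ ·) c → c.Nonempty → (∀ Z ∈ c, Q Z) → Q (sSup c))
    (step : ∀ Z, U ≤ Z → Q Z → Z ≠ ⊤ → ∃ (S : ClosedTree) (x : X.obj (op S)),
      x ∉ Z.obj (op S) ∧ InjectiveRel Z x ∧ Q (Z ⊔ Subfunctor.ofSection x) ∧
        HasLiftingProperty (cellBoundary Z x).ι p) :
    HasLiftingProperty U.ι p := by
  refine ⟨fun {t b} sq => ?_⟩
  let P := FunctorToTypes.prod X E
  let fst : P ⟶ X := FunctorToTypes.prod.fst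
  let A : Set (Subfunctor P) := {Γ | (∀ R x e e', (x, e) ∈ Γ.obj R → (x, e') ∈ Γ.obj R → e = e') ∧
    (∀ R z, z ∈ Γ.obj R → p.app R z.2 = b.app R z.1) ∧ Q (Γ.image fst)}
  let Γ₀ : Subfunctor P := Subfunctor.range (FunctorToTypes.prod.lift U.ι t)
  have h₀ : Γ₀ ∈ A := by
    refine ⟨?_, ?_, ?_⟩
    · rintro R x e e' ⟨u, hu⟩ ⟨u', hu'⟩
      obtain ⟨h1, h2⟩ := Prod.mk.inj hu
      obtain ⟨h1', h2'⟩ := Prod.mk.inj hu'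
      have : u = u' := Subtype.ext (h1.trans h1'.symm)
      rw [← h2, ← h2', this]
    · rintro R _ ⟨u, rfl⟩
      exact ConcreteCategory.congr_hom (NatTrans.congr_app sq.w R) u
    · have : Γ₀.image fst = U := by
        rw [← Subfunctor.range_comp]
        exact U.range_ι
      rwa [this]
  have mem {c : Set (Subfunctor P)} R z (hz : z ∈ (sSup c).obj R) : ∃ Γ ∈ c, z ∈ Γ.obj R := by
    simpa [Subfunctor.sSup_obj] using hz
  have mono {Γ Γ' : Subfunctor P} (h : Γ ≤ Γ') : Γ.image fst ≤ Γ'.image fst := by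
    rintro R _ ⟨z, hz, rfl⟩
    exact ⟨z, h R hz, rfl⟩
  obtain ⟨Γ, hΓ₀, hΓ⟩ := zorn_le_nonempty₀ A (fun c hc hc' Γ₁ hΓ₁ => by
    refine ⟨sSup c, ⟨?_, ?_, ?_⟩, fun Γ hΓ => le_sSup hΓ⟩
    · intro R x e e' h h'
      obtain ⟨Γ, hΓ, h⟩ := mem R _ h
      obtain ⟨Γ', hΓ', h'⟩ := mem R _ h'
      rcases hc'.total hΓ hΓ' with hle | hle
      · exact (hc hΓ').1 R x e e' (hle R h) h'
      · exact (hc hΓ).1 R x e e' h (hle R h')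
    · intro R z hz
      obtain ⟨Γ, hΓ, hz⟩ := mem R _ hz
      exact (hc hΓ).2.1 R z hz
    · have : (sSup c).image fst = sSup ((·.image fst) '' c) := by
        refine le_antisymm ?_ (sSup_le ?_)
        · rintro R _ ⟨z, hz, rfl⟩
          obtain ⟨Γ, hΓ, hz⟩ := mem R _ hz
          have h : Γ.image fst ≤ sSup ((·.image fst) '' c) := le_sSup ⟨Γ, hΓ, rfl⟩
          exact h R ⟨z, hz, rfl⟩
        · rintro _ ⟨Γ, hΓ, rfl⟩
          exact mono (le_sSup hΓ)
      rw [this]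
      refine hQ _ ?_ ⟨_, Γ₁, hΓ₁, rfl⟩ ?_
      · rintro _ ⟨Γ, hΓ, rfl⟩ _ ⟨Γ', hΓ', rfl⟩ -
        exact (hc'.total hΓ hΓ').imp mono mono
      · rintro _ ⟨Γ, h, rfl⟩
        exact (hc h).2.2) Γ₀ h₀
  obtain ⟨⟨h1, h2, h3⟩, hmax⟩ := hΓ
  by_cases htop : Γ.image fst = ⊤
  · obtain ⟨g, hg⟩ := exists_hom_of_functional Γ h1 (𝟙 X) (fun R y => by
      change _ ∈ (Γ.image fst).obj R
      rw [htop]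
      trivial)
    refine ⟨⟨⟨g, ?_, ?_⟩⟩⟩
    · ext R u
      exact h1 R _ _ _ (hg R u.1) (hΓ₀ R ⟨u, rfl⟩)
    · ext R x
      exact h2 R _ (hg R x)
  · exfalso
    have hUZ : U ≤ Γ.image fst := fun R u hu => ⟨_, hΓ₀ R ⟨⟨u, hu⟩, rfl⟩, rfl⟩
    obtain ⟨S, x, hx, hinj, hQ', hlift⟩ := step _ hUZ h3 htop
    let K := cellBoundary (Γ.image fst) x
    obtain ⟨g, hg⟩ := exists_hom_of_functional Γ h1 (K.ι ≫ yonedaEquiv.symm x)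
      (fun R y => y.2)
    have sq' : CommSq g K.ι p (yonedaEquiv.symm x ≫ b) := ⟨by
      ext R y
      exact h2 R _ (hg R y)⟩
    let ℓ := sq'.lift
    let Γ' : Subfunctor P := Γ ⊔ Subfunctor.range (FunctorToTypes.prod.lift (yonedaEquiv.symm x) ℓ)
    have hℓ {R : ClosedTreeᵒᵖ} (f : R.unop ⟶ S)
        (hf : X.map f.op x ∈ (Γ.image fst).obj R) : (X.map f.op x, ℓ.app R f) ∈ Γ.obj R := by
      have := hg R ⟨f, hf⟩
      rw [← sq'.fac_left] at this
      exact this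
    have hdom {R : ClosedTreeᵒᵖ} {y e} (h : (y, e) ∈ Γ'.obj R)
        (hy : y ∈ (Γ.image fst).obj R) : (y, e) ∈ Γ.obj R := by
      rcases h with h | ⟨f, hf⟩
      · exact h
      · obtain ⟨rfl, rfl⟩ := Prod.mk.inj hf
        exact hℓ f hy
    have hΓ' : Γ' ∈ A := by
      refine ⟨?_, ?_, ?_⟩
      · intro R y e e' h h'
        by_cases hy : y ∈ (Γ.image fst).obj R
        · exact h1 R _ _ _ (hdom h hy) (hdom h' hy)
        · rcases h with h | ⟨f, hf⟩
          · exact (hy ⟨_, h, rfl⟩).elim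
          rcases h' with h' | ⟨f', hf'⟩
          · exact (hy ⟨_, h', rfl⟩).elim
          obtain ⟨hx1, rfl⟩ := Prod.mk.inj hf
          obtain ⟨hx2, rfl⟩ := Prod.mk.inj hf'
          rw [hinj R.unop f f' (hx1.trans hx2.symm) (by
            have := hy
            rwa [← hx1] at this)]
      · rintro R _ (h | ⟨f, rfl⟩)
        · exact h2 R _ h
        · exact ConcreteCategory.congr_hom (NatTrans.congr_app sq'.fac_right R) f
      · have : Γ'.image fst = Γ.image fst ⊔ Subfunctor.ofSection x := by
          refine le_antisymm ?_ (sup_le (mono le_sup_left) ?_)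
          · rintro R _ ⟨z, hz | ⟨f, rfl⟩, rfl⟩
            · exact Or.inl ⟨z, hz, rfl⟩
            · exact Or.inr ⟨f.op, rfl⟩
          · rintro R _ ⟨f, rfl⟩
            exact ⟨_, Or.inr ⟨f.unop, rfl⟩, rfl⟩
        rwa [this]
    -- By maximality the extension lies in `Γ`, so `x`, its own restriction along `𝟙 S`, was already
    -- in the domain.
    refine hx ⟨_, hmax hΓ' le_sup_left _ (Or.inr ⟨𝟙 S, rfl⟩), ?_⟩
    exact ConcreteCategory.congr_hom (X.map_id _) x

end Cells

/-! ### Faces of closed trees -/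

lemma ClosedTree.hom_ext {S T : ClosedTree} {f g : S ⟶ T} (h : ∀ a, onEdges f a = onEdges g a) :
    f = g :=
  ObjectProperty.hom_ext _ (Tree.Hom.ext (funext h))

/-- A map from the edges of a closed tree to a poset which preserves the order and incomparability
of edges. -/
def IsLabelling {R : ClosedTree} {P : Type*} [LE P] (φ : R.Edge → P) : Prop :=
  (∀ a b, a ≤ b → φ a ≤ φ b) ∧ ∀ a b, Incomp a b → Incomp (φ a) (φ b)

lemma isLabelling_onEdges {R S : ClosedTree} (f : R ⟶ S) : IsLabelling (onEdges f) :=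
  ⟨fun _ _ => onEdges_mono f, fun _ _ => onEdges_incomp f⟩

/-- A labelling factors through every labelling with a larger image. -/
lemma IsLabelling.exists_factor {R R' : ClosedTree} {P : Type*} [PartialOrder P] {φ : R.Edge → P}
    {φ' : R'.Edge → P} (h : IsLabelling φ) (h' : IsLabelling φ') (s : P → R'.Edge)
    (hs : ∀ a, φ' (s (φ a)) = φ a) : ∃ k : R ⟶ R', ∀ a, onEdges k a = s (φ a) := by
  refine ⟨mkHom (fun a => s (φ a)) (fun a b hab => ?_) (fun a b hab => ?_), fun a => rfl⟩
  · have h1 := h.1 a b hab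
    -- Two edges of `R'` are related one way, the other way, or incomparable. As `φ'` preserves each
    -- relation, antisymmetry of `P` excludes the unwanted ones; so any choice of preimages is a
    -- morphism.
    by_contra hle
    by_cases hle' : s (φ b) ≤ s (φ a)
    · have := h'.1 _ _ hle'
      rw [hs, hs] at this
      exact hle (congrArg s (le_antisymm h1 this)).le
    · have := (h'.2 _ _ ⟨hle, hle'⟩).1
      rw [hs, hs] at this
      exact this h1
  · obtain ⟨h1, h2⟩ := h.2 a b hab
    rw [← hs a, ← hs b] at h1 h2
    exact ⟨fun h => h1 (h'.1 _ _ h), fun h => h2 (h'.1 _ _ h)⟩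

lemma IsLabelling.exists_factor_of_range_subset {R R' : ClosedTree} {P : Type*} [PartialOrder P]
    {φ : R.Edge → P} {φ' : R'.Edge → P} (h : IsLabelling φ) (h' : IsLabelling φ')
    (hφ : Set.range φ ⊆ Set.range φ') : ∃ k : R ⟶ R', ∀ a, φ' (onEdges k a) = φ a := by
  classical
  obtain ⟨k, hk⟩ := h.exists_factor h' (fun x => if hx : ∃ b, φ' b = x then hx.choose else ⊥)
    (fun a => by
      have : ∃ b, φ' b = φ a := hφ ⟨a, rfl⟩
      rw [dif_pos this]
      exact this.choose_spec)
  refine ⟨k, fun a => ?_⟩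
  have : ∃ b, φ' b = φ a := hφ ⟨a, rfl⟩
  rw [hk, dif_pos this]
  exact this.choose_spec

lemma exists_factor_of_range_subset {R S T : ClosedTree} (f : R ⟶ T) (g : S ⟶ T)
    (h : Set.range (onEdges f) ⊆ Set.range (onEdges g)) : ∃ k : R ⟶ S, k ≫ g = f := by
  obtain ⟨k, hk⟩ := (isLabelling_onEdges f).exists_factor_of_range_subset (isLabelling_onEdges g) h
  exact ⟨k, hom_ext hk⟩

/-- A set of elements of a finite poset is tree-like if it has a smallest element and the elements
of the set below a given element of the set are linearly ordered. -/
structure IsTreeLike {P : Type*} [PartialOrder P] (B : Set P) : Prop where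
  exists_min : ∃ m ∈ B, ∀ x ∈ B, m ≤ x
  total : ∀ x ∈ B, ∀ y ∈ B, ∀ z ∈ B, x ≤ z → y ≤ z → x ≤ y ∨ y ≤ x

section SubTree

variable {P : Type} [PartialOrder P] [Finite P] {B : Set P} (hB : IsTreeLike B)

/-- The closed tree with a given tree-like set of edges. -/
def subTree : ClosedTree :=
  letI : OrderBot B :=
    { bot := ⟨hB.exists_min.choose, hB.exists_min.choose_spec.1⟩
      bot_le := fun x => hB.exists_min.choose_spec.2 x.1 x.2 }
  ofPoset B fun a b c => hB.total a.1 a.2 b.1 b.2 c.1 c.2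

/-- The edges of `subTree`. -/
def subTreeIso : (subTree hB).Edge ≃o B :=
  letI : OrderBot B :=
    { bot := ⟨hB.exists_min.choose, hB.exists_min.choose_spec.1⟩
      bot_le := fun x => hB.exists_min.choose_spec.2 x.1 x.2 }
  ofPosetIso B fun a b c => hB.total a.1 a.2 b.1 b.2 c.1 c.2

/-- The inclusion of the edges of `subTree`. -/
def subTreeLabel (a : (subTree hB).Edge) : P := (subTreeIso hB a).1

lemma subTreeLabel_le_iff {a b : (subTree hB).Edge} :
    subTreeLabel hB a ≤ subTreeLabel hB b ↔ a ≤ b :=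
  (subTreeIso hB).le_iff_le

lemma subTreeLabel_injective : Function.Injective (subTreeLabel hB) :=
  Subtype.val_injective.comp (subTreeIso hB).injective

lemma subTreeLabel_mem (a : (subTree hB).Edge) : subTreeLabel hB a ∈ B := (subTreeIso hB a).2

lemma exists_subTreeLabel_eq {x : P} (hx : x ∈ B) : ∃ a, subTreeLabel hB a = x :=
  ⟨(subTreeIso hB).symm ⟨x, hx⟩, by simp [subTreeLabel]⟩

lemma range_subTreeLabel : Set.range (subTreeLabel hB) = B :=
  Set.Subset.antisymm (Set.range_subset_iff.2 (subTreeLabel_mem hB))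
    fun _ => exists_subTreeLabel_eq hB

lemma subTreeLabel_incomp_iff {a b : (subTree hB).Edge} :
    Incomp (subTreeLabel hB a) (subTreeLabel hB b) ↔ Incomp a b := by
  simp only [Incomp, subTreeLabel_le_iff]

end SubTree

section Face

variable {T : ClosedTree} {B : Set T.Edge}

lemma isTreeLike_of_min (h : ∃ m ∈ B, ∀ x ∈ B, m ≤ x) : IsTreeLike B :=
  ⟨h, fun _ _ _ _ _ _ => T.total_below⟩

/-- The inclusion of a face. -/
def faceInclusion (hB : IsTreeLike B) : subTree hB ⟶ T :=
  mkHom (subTreeLabel hB) (fun _ _ => (subTreeLabel_le_iff hB).2)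
    (fun _ _ => (subTreeLabel_incomp_iff hB).2)

lemma onEdges_faceInclusion (hB : IsTreeLike B) :
    onEdges (faceInclusion hB) = subTreeLabel hB := rfl

end Face

lemma isTreeLike_range {R T : ClosedTree} (f : R ⟶ T) : IsTreeLike (Set.range (onEdges f)) :=
  isTreeLike_of_min ⟨_, ⟨⊥, rfl⟩, by
    rintro _ ⟨a, rfl⟩
    exact onEdges_mono f bot_le⟩

/-! ### Boundaries and normal monomorphisms -/

/-- The boundary of a closed tree, which consists of all maps that are not surjective on edges. -/
def boundary (T : ClosedTree) : Subfunctor (yoneda.obj T) where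
  obj R := {f | ¬ Function.Surjective (onEdges f)}
  map r f hf h := hf fun a => by
    obtain ⟨b, hb⟩ := h a
    exact ⟨onEdges r.unop b, hb⟩

lemma exists_section {R T : ClosedTree} {f : R ⟶ T} (hf : Function.Surjective (onEdges f)) :
    ∃ s : T ⟶ R, s ≫ f = 𝟙 T :=
  exists_factor_of_range_subset (𝟙 T) f fun a _ => hf a

/-- Being able to prescribe the preimage `r` allows sections to detect whether two surjections agree
at `r`. -/
lemma exists_section_apply {R T : ClosedTree} {f : R ⟶ T} (hf : Function.Surjective (onEdges f))
    (r : R.Edge) : ∃ s : T ⟶ R, s ≫ f = 𝟙 T ∧ onEdges s (onEdges f r) = r := by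
  classical
  have key (x : T.Edge) : onEdges f (if x = onEdges f r then r else (hf x).choose) = x := by
    split_ifs with h
    · exact h.symm
    · exact (hf x).choose_spec
  obtain ⟨s, hs⟩ := (isLabelling_onEdges (𝟙 T)).exists_factor (isLabelling_onEdges f)
    (fun x => if x = onEdges f r then r else (hf x).choose) (fun a => key a)
  have hs' (a) : onEdges s a = if a = onEdges f r then r else (hf a).choose := hs a
  refine ⟨s, hom_ext fun a => ?_, ?_⟩
  · change onEdges f (onEdges s a) = a
    rw [hs', key]
  · rw [hs', if_pos rfl]

/-- The automorphism given by a surjective endomorphism. -/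
lemma exists_aut_of_surjective {T : ClosedTree} {f : T ⟶ T}
    (hf : Function.Surjective (onEdges f)) : ∃ σ : Aut T, σ.hom = f := by
  obtain ⟨s, hs⟩ := exists_section hf
  refine ⟨⟨f, s, hom_ext fun a => ?_, hs⟩, rfl⟩
  have hinj := Finite.injective_iff_surjective.2 hf
  apply hinj
  exact congrArg (fun k => onEdges k (onEdges f a)) hs

/-- A normal monomorphism has the left lifting property against every morphism which has the right
lifting property against all inclusions of boundaries. -/
lemma IsNormalMono.hasLiftingProperty {U X E B : ClosedDendroidalSet} {i : U ⟶ X}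
    (hi : IsNormalMono i) {p : E ⟶ B} (hp : ∀ T, HasLiftingProperty (boundary T).ι p) :
    HasLiftingProperty i p := by
  have := hi.1
  have e : CategoryTheory.Arrow.mk i ≅ CategoryTheory.Arrow.mk (Subfunctor.range i).ι :=
    CategoryTheory.Arrow.isoMk (asIso (Subfunctor.toRange i)) (Iso.refl _) (Category.comp_id _).symm
  rw [HasLiftingProperty.iff_of_arrow_iso_left e]
  refine hasLiftingProperty_of_cells (fun _ => True) trivial (fun _ _ _ _ => trivial)
    fun Z hUZ _ hZ => ?_
  -- The cell is a dendrex outside `Z` with the fewest edges. Its restriction along `f` lies in `Z`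
  -- exactly if `f` is not surjective: a surjection has a section, and any other map factors through
  -- a smaller tree.
  have hex : ∃ n, ∃ (S : ClosedTree) (x : X.obj (op S)), Nat.card S.Edge = n ∧ x ∉ Z.obj (op S) := by
    by_contra hcon
    push Not at hcon
    refine hZ (top_le_iff.1 fun R x _ => hcon _ R.unop x rfl)
  classical
  obtain ⟨S, x, hn, hx⟩ := Nat.find_spec hex
  have hmin (S' : ClosedTree) (x' : X.obj (op S')) (h : Nat.card S'.Edge < Nat.card S.Edge) :
      x' ∈ Z.obj (op S') := by
    by_contra hx'
    exact Nat.find_min hex (hn ▸ h) ⟨S', x', rfl, hx'⟩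
  have hmem {R : ClosedTree} (f : R ⟶ S) :
      X.map f.op x ∈ Z.obj (op R) ↔ ¬ Function.Surjective (onEdges f) := by
    constructor
    · intro h hf
      obtain ⟨s, hs⟩ := exists_section hf
      refine hx ?_
      have := Z.map s.op h
      rwa [Set.mem_preimage, ← Functor.map_comp_apply, ← op_comp, hs, op_id,
        Functor.map_id_apply] at this
    · intro hf
      obtain ⟨k, hk⟩ := exists_factor_of_range_subset f (faceInclusion (isTreeLike_range f)) (by
        rw [onEdges_faceInclusion, range_subTreeLabel])
      rw [← hk, op_comp, Functor.map_comp_apply]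
      refine Z.map k.op (hmin _ _ ?_)
      rw [Nat.card_congr (subTreeIso (isTreeLike_range f)).toEquiv]
      exact Set.ncard_lt_card fun h => hf (Set.range_eq_univ.1 h)
  refine ⟨S, x, hx, fun R f f' h hf => ?_, trivial, ?_⟩
  · have hf' := hf
    rw [h] at hf'
    rw [hmem, not_not] at hf hf'
    refine hom_ext fun r => ?_
    -- For a section `s` of `f` through `r`, the map `s ≫ f'` fixes `x`. Hence it is surjective, so
    -- an automorphism, so trivial by freeness, and `f'` agrees with `f` at `r`.
    obtain ⟨s, hs, hsr⟩ := exists_section_apply hf r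
    have hx' : X.map (s ≫ f').op x = x := by
      rw [op_comp, Functor.map_comp_apply, ← h, ← Functor.map_comp_apply, ← op_comp,
        hs, op_id, Functor.map_id_apply]
    have hsf : Function.Surjective (onEdges (s ≫ f')) := by
      by_contra hcon
      rw [← hmem, hx'] at hcon
      exact hx hcon
    obtain ⟨σ, hσ⟩ := exists_aut_of_surjective hsf
    have hσ1 : σ = 1 := hi.2 S σ x (fun h => hx (hUZ _ h)) (by rwa [hσ])
    have h1 : s ≫ f' = 𝟙 S := by
      rw [← hσ, hσ1]
      rfl
    have h2 : onEdges f' (onEdges s (onEdges f r)) = onEdges f r :=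
      congrArg (fun k => onEdges k (onEdges f r)) h1
    rw [← h2, hsr]
  · have : cellBoundary Z x = boundary S := by
      ext R f
      exact hmem f
    rw [this]
    exact hp S

/-! ### Very inner horns -/

/-- The very inner horn consists of all maps which miss an edge other than the given one. -/
lemma mem_horn_iff {T : ClosedTree} {e : T.Edge} (he : T.IsVeryInner e) {R : ClosedTree}
    (f : R ⟶ T) : f ∈ (horn T e).obj (op R) ↔ ∃ d, d ≠ e ∧ d ∉ Set.range (onEdges f) := by
  constructor
  · rintro ⟨d, F, δ, k, hd, hδ, h⟩
    refine ⟨d, hd, ?_⟩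
    rintro ⟨a, rfl⟩
    have : onEdges f a ∈ Set.range (onEdges δ) := ⟨onEdges k a, by rw [h]; rfl⟩
    rw [hδ.2] at this
    exact this rfl
  · intro hex
    suffices H : ∃ d, d ≠ e ∧ d ∉ Set.range (onEdges f) ∧ ∃ m ∈ ({d}ᶜ : Set T.Edge),
        ∀ x ∈ ({d}ᶜ : Set T.Edge), m ≤ x by
      obtain ⟨d, hd, hdf, hmin⟩ := H
      let hB := isTreeLike_of_min hmin
      obtain ⟨k, hk⟩ := exists_factor_of_range_subset f (faceInclusion hB) (by
        rw [onEdges_faceInclusion, range_subTreeLabel]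
        rintro _ ⟨a, rfl⟩ rfl
        exact hdf ⟨a, rfl⟩)
      exact ⟨d, subTree hB, faceInclusion hB, k, hd,
        ⟨subTreeLabel_injective hB, range_subTreeLabel hB⟩, hk.symm⟩
    by_cases hne : ∃ d, d ≠ ⊥ ∧ d ≠ e ∧ d ∉ Set.range (onEdges f)
    · obtain ⟨d, hd, hde, hdf⟩ := hne
      exact ⟨d, hde, hdf, ⊥, hd.symm, fun x _ => bot_le⟩
    -- Now only the root, and possibly `e`, is missed. All other edges are above the image of the
    -- root of `R`. An input `a` of `e` is above both this image and `e`, so these are comparable,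
    -- and the smaller one is the least edge other than the root. Thus the root face exists.
    · push Not at hne
      obtain ⟨d, hde, hdf⟩ := hex
      obtain rfl : d = ⊥ := by
        by_contra h
        exact hdf (hne d h hde)
      refine ⟨⊥, hde, hdf, ?_⟩
      obtain ⟨a, ha⟩ := he.2
      have hea : e < a := (show e ⋖ a from ha).1
      have hr : onEdges f ⊥ ≠ ⊥ := fun h => hdf ⟨⊥, h⟩
      have hle (x : T.Edge) (h1 : x ≠ ⊥) (h2 : x ≠ e) : onEdges f ⊥ ≤ x := by
        obtain ⟨b, rfl⟩ := hne x h1 h2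
        exact onEdges_mono f bot_le
      have hra := hle a (ne_bot_of_gt hea) hea.ne'
      rcases T.total_below hra hea.le with h | h
      · refine ⟨_, hr, fun x hx => ?_⟩
        by_cases hxe : x = e
        · rwa [hxe]
        · exact hle x hx hxe
      · refine ⟨e, he.1, fun x hx => ?_⟩
        by_cases hxe : x = e
        · rw [hxe]
        · exact h.trans (hle x hx hxe)

/-! ### The tensor product of trees as a presheaf -/

/-- The presheaf `S ⊗ T`, the union of all the shuffles of `S` and `T`. -/
def treeTensor (S T : ClosedTree) : ClosedDendroidalSet where
  obj R := TreeTensor S T R.unop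
  map r := TypeCat.ofHom fun φ => φ.restrict r.unop

lemma le_of_onEdges_le {S T : ClosedTree} {f : S ⟶ T} (hf : Function.Injective (onEdges f))
    {a b : S.Edge} (h : onEdges f a ≤ onEdges f b) : a ≤ b := by
  by_contra hab
  by_cases hba : b ≤ a
  · exact hab (hf (le_antisymm h (onEdges_mono f hba))).le
  · exact (onEdges_incomp f ⟨hab, hba⟩).1 h

namespace TreeTensor

variable {S T R : ClosedTree}

lemma monotone (ψ : TreeTensor S T R) : Monotone ψ.1 := ((isTensorDendrex_iff _).1 ψ.2).1

lemma incomp (ψ : TreeTensor S T R) {a b : R.Edge} (h : Incomp a b) :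
    Incomp (ψ.1 a).1 (ψ.1 b).1 ∨ Incomp (ψ.1 a).2 (ψ.1 b).2 :=
  ((isTensorDendrex_iff _).1 ψ.2).2 a b h

lemma exists_push_eq {F G : ClosedTree} {f : F ⟶ S} {g : G ⟶ T} (ψ : TreeTensor S T R)
    (hf : Function.Injective (onEdges f)) (hg : Function.Injective (onEdges g))
    (h1 : ∀ r, (ψ.1 r).1 ∈ Set.range (onEdges f)) (h2 : ∀ r, (ψ.1 r).2 ∈ Set.range (onEdges g)) :
    ∃ φ : TreeTensor F G R, φ.push f g = ψ := by
  choose a ha using h1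
  choose b hb using h2
  refine ⟨⟨fun r => (a r, b r), (isTensorDendrex_iff _).2 ⟨fun r r' h => ?_, fun r r' h => ?_⟩⟩,
    Subtype.ext (funext fun r => Prod.ext (ha r) (hb r))⟩
  · refine ⟨le_of_onEdges_le hf ?_, le_of_onEdges_le hg ?_⟩
    · rw [ha, ha]
      exact (ψ.monotone h).1
    · rw [hb, hb]
      exact (ψ.monotone h).2
  · refine (ψ.incomp h).imp (fun k => ?_) (fun k => ?_)
    · rw [← ha, ← ha] at k
      exact ⟨fun h => k.1 (onEdges_mono f h), fun h => k.2 (onEdges_mono f h)⟩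
    · rw [← hb, ← hb] at k
      exact ⟨fun h => k.1 (onEdges_mono g h), fun h => k.2 (onEdges_mono g h)⟩

lemma isTreeLike_fst (ψ : TreeTensor S T R) : IsTreeLike (Set.range fun r => (ψ.1 r).1) :=
  isTreeLike_of_min ⟨_, ⟨⊥, rfl⟩, by
    rintro _ ⟨r, rfl⟩
    exact (ψ.monotone bot_le).1⟩

lemma isTreeLike_snd (ψ : TreeTensor S T R) : IsTreeLike (Set.range fun r => (ψ.1 r).2) :=
  isTreeLike_of_min ⟨_, ⟨⊥, rfl⟩, by
    rintro _ ⟨r, rfl⟩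
    exact (ψ.monotone bot_le).2⟩

/-- The smallest face of `S` containing the first components of the labels. -/
def fstFace (ψ : TreeTensor S T R) : subTree ψ.isTreeLike_fst ⟶ S := faceInclusion _

/-- The smallest face of `T` containing the second components of the labels. -/
def sndFace (ψ : TreeTensor S T R) : subTree ψ.isTreeLike_snd ⟶ T := faceInclusion _

lemma exists_push_faces_eq (ψ : TreeTensor S T R) :
    ∃ φ : TreeTensor (subTree ψ.isTreeLike_fst) (subTree ψ.isTreeLike_snd) R,
      φ.push ψ.fstFace ψ.sndFace = ψ :=
  exists_push_eq ψ (subTreeLabel_injective _) (subTreeLabel_injective _)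
    (fun r => exists_subTreeLabel_eq ψ.isTreeLike_fst ⟨r, rfl⟩)
    (fun r => exists_subTreeLabel_eq ψ.isTreeLike_snd ⟨r, rfl⟩)

/-- The labelling with values in the smallest faces of `S` and `T`. -/
def corestrict (ψ : TreeTensor S T R) :
    TreeTensor (subTree ψ.isTreeLike_fst) (subTree ψ.isTreeLike_snd) R :=
  ψ.exists_push_faces_eq.choose

lemma push_corestrict (ψ : TreeTensor S T R) : ψ.corestrict.push ψ.fstFace ψ.sndFace = ψ :=
  ψ.exists_push_faces_eq.choose_spec

end TreeTensor

/-! ### Tensor products of subpresheaves of representables -/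

section Eval

variable {S T : ClosedTree} {A B : ClosedDendroidalSet}

/-- The map from `A ⊗ B` to `S ⊗ T` induced by maps from `A` to `S` and from `B` to `T`. -/
def tensorEval (a : A ⟶ yoneda.obj S) (b : B ⟶ yoneda.obj T) : tensorObj A B ⟶ treeTensor S T where
  app R := TypeCat.ofHom (Quot.lift
    (fun p => p.φ.push (show p.S ⟶ S from a.app _ p.x) (show p.T ⟶ T from b.app _ p.y)) (by
      rintro _ _ ⟨f, g, x', y', φ⟩
      dsimp only
      rw [NatTrans.naturality_apply a f.op x', NatTrans.naturality_apply b g.op y']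
      rfl))
  naturality R R' r := by
    ext ⟨p⟩
    rfl

variable {R : ClosedTree} {a : A ⟶ yoneda.obj S} {b : B ⟶ yoneda.obj T}

/-- A dendrex `x` of a subpresheaf of a representable presheaf extends, up to a map which does not
change `x`, over all edges in its image. -/
lemma exists_retraction [Mono a] {S' F : ClosedTree} (x : A.obj (op S')) {f : F ⟶ S}
    (hf : Set.range (onEdges f) ⊆ Set.range (onEdges (show S' ⟶ S from a.app _ x))) :
    ∃ (u : S' ⟶ S') (k : F ⟶ S'), A.map u.op x = x ∧ a.app _ (A.map k.op x) = f ∧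
      ∀ r c, onEdges (show S' ⟶ S from a.app _ x) r = onEdges f c → onEdges u r = onEdges k c := by
  classical
  let g : S' ⟶ S := a.app _ x
  -- One choice of preimages serves for both `u` and `k`, so that they agree on edges with the same
  -- image. The default value `⊥` is never reached.
  let s : S.Edge → S'.Edge := fun x => if hx : ∃ b, onEdges g b = x then hx.choose else ⊥
  have hs {x : S.Edge} (hx : ∃ b, onEdges g b = x) : onEdges g (s x) = x := by
    dsimp only [s]
    rw [dif_pos hx]
    exact hx.choose_spec
  obtain ⟨u, hu⟩ := (isLabelling_onEdges g).exists_factor (isLabelling_onEdges g) s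
    fun r => hs ⟨r, rfl⟩
  obtain ⟨k, hk⟩ := (isLabelling_onEdges f).exists_factor (isLabelling_onEdges g) s
    fun r => hs (hf ⟨r, rfl⟩)
  have hinj := (mono_iff_injective (a.app (op S'))).1 inferInstance
  refine ⟨u, k, hinj ?_, ?_, fun r c hrc => ?_⟩
  · rw [NatTrans.naturality_apply]
    refine hom_ext (f := u ≫ g) (g := g) fun r => ?_
    change onEdges g (onEdges u r) = _
    rw [hu, hs ⟨r, rfl⟩]
  · rw [NatTrans.naturality_apply]
    refine hom_ext (f := k ≫ g) (g := f) fun r => ?_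
    change onEdges g (onEdges k r) = _
    rw [hk, hs (hf ⟨r, rfl⟩)]
  · rw [hu, hk]
    exact congrArg s hrc

/-- The normal form of a dendrex of `A ⊗ B` for subpresheaves `A` and `B` of representables. -/
lemma exists_eq_tensorMk [Mono a] [Mono b] (z : (tensorObj A B).obj (op R))
    (ψ : TreeTensor S T R) (hψ : (tensorEval a b).app (op R) z = ψ) :
    ∃ (x : A.obj (op (subTree ψ.isTreeLike_fst))) (y : B.obj (op (subTree ψ.isTreeLike_snd))),
      a.app _ x = ψ.fstFace ∧ b.app _ y = ψ.sndFace ∧ z = tensorMk x y ψ.corestrict := by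
  obtain ⟨⟨S', T', x, y, φ⟩⟩ := z
  have hψ' (r) : ψ.1 r = (onEdges (show S' ⟶ S from a.app _ x) (φ.1 r).1,
      onEdges (show T' ⟶ T from b.app _ y) (φ.1 r).2) := by
    rw [← hψ]
    rfl
  have hc (r) : ψ.1 r = (onEdges ψ.fstFace (ψ.corestrict.1 r).1,
      onEdges ψ.sndFace (ψ.corestrict.1 r).2) :=
    (congrArg (fun t : TreeTensor S T R => t.1 r) ψ.push_corestrict).symm
  obtain ⟨u, k, hu, hk, huk⟩ := exists_retraction (a := a) x (f := ψ.fstFace) (by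
    rw [TreeTensor.fstFace, onEdges_faceInclusion, range_subTreeLabel]
    rintro _ ⟨r, rfl⟩
    exact ⟨(φ.1 r).1, (congrArg Prod.fst (hψ' r)).symm⟩)
  obtain ⟨v, l, hv, hl, hvl⟩ := exists_retraction (a := b) y (f := ψ.sndFace) (by
    rw [TreeTensor.sndFace, onEdges_faceInclusion, range_subTreeLabel]
    rintro _ ⟨r, rfl⟩
    exact ⟨(φ.1 r).2, (congrArg Prod.snd (hψ' r)).symm⟩)
  refine ⟨_, _, hk, hl, ?_⟩
  rw [tensorMk_map]
  change tensorMk x y φ = _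
  -- Since `u` and `v` fix `x` and `y`, `φ` may be replaced by its image under them, which factors
  -- through the smallest faces.
  conv_lhs => rw [← hu, ← hv]
  rw [tensorMk_map]
  congr 1
  refine Subtype.ext (funext fun r => ?_)
  have h := (hψ' r).symm.trans (hc r)
  exact Prod.ext (huk _ _ (congrArg Prod.fst h)) (hvl _ _ (congrArg Prod.snd h))

/-- The image `ψ` determines the normal form: `x` and `y` are determined by the two faces because
`a` and `b` are mono. -/
lemma tensorEval_injective [Mono a] [Mono b] : Function.Injective ((tensorEval a b).app (op R)) := by
  intro z z' h
  obtain ⟨x, y, hx, hy, hz⟩ := exists_eq_tensorMk (a := a) (b := b) z _ h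
  obtain ⟨x', y', hx', hy', hz'⟩ := exists_eq_tensorMk (a := a) (b := b) z' _ rfl
  have h1 : x = x' := (mono_iff_injective (a.app _)).1 inferInstance (hx.trans hx'.symm)
  have h2 : y = y' := (mono_iff_injective (b.app _)).1 inferInstance (hy.trans hy'.symm)
  exact hz.trans ((by rw [h1, h2] : tensorMk x y _ = tensorMk x' y' _).trans hz'.symm)

end Eval

/-! ### The pushout-product as a subpresheaf of `S ⊗ T` -/

section PushoutProduct

variable {S T : ClosedTree} {A B : ClosedDendroidalSet} (a : A ⟶ yoneda.obj S)
  (b : B ⟶ yoneda.obj T)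

instance : IsIso (tensorEval (𝟙 (yoneda.obj S)) (𝟙 (yoneda.obj T))) := by
  rw [NatTrans.isIso_iff_isIso_app]
  intro R
  rw [isIso_iff_bijective]
  exact ⟨tensorEval_injective, fun ψ => ⟨tensorMk (X := yoneda.obj S) (Y := yoneda.obj T) (𝟙 S) (𝟙 T) ψ, rfl⟩⟩

/-- The pushout-product of maps to representable presheaves as a map to `S ⊗ T`. -/
def pushoutProductEval :
    pushout ((tensor.obj A).map b) ((tensor.map a).app B) ⟶ treeTensor S T :=
  pushoutProduct a b ≫ tensorEval (𝟙 (yoneda.obj S)) (𝟙 (yoneda.obj T))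

variable {R : ClosedTree}

lemma pushoutProductEval_inl (z : (tensorObj A (yoneda.obj T)).obj (op R)) :
    (pushoutProductEval a b).app (op R)
      ((pushout.inl ((tensor.obj A).map b) ((tensor.map a).app B)).app (op R) z) =
      (tensorEval a (𝟙 (yoneda.obj T))).app (op R) z := by
  have h : pushout.inl ((tensor.obj A).map b) ((tensor.map a).app B) ≫ pushoutProduct a b = _ :=
    pushout.inl_desc _ _ _
  refine (congrArg ((tensorEval (𝟙 (yoneda.obj S)) (𝟙 (yoneda.obj T))).app (op R))
    (ConcreteCategory.congr_hom (NatTrans.congr_app h (op R)) z)).trans ?_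
  obtain ⟨p⟩ := z
  rfl

lemma pushoutProductEval_inr (z : (tensorObj (yoneda.obj S) B).obj (op R)) :
    (pushoutProductEval a b).app (op R)
      ((pushout.inr ((tensor.obj A).map b) ((tensor.map a).app B)).app (op R) z) =
      (tensorEval (𝟙 (yoneda.obj S)) b).app (op R) z := by
  have h : pushout.inr ((tensor.obj A).map b) ((tensor.map a).app B) ≫ pushoutProduct a b = _ :=
    pushout.inr_desc _ _ _
  refine (congrArg ((tensorEval (𝟙 (yoneda.obj S)) (𝟙 (yoneda.obj T))).app (op R))
    (ConcreteCategory.congr_hom (NatTrans.congr_app h (op R)) z)).trans ?_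
  obtain ⟨p⟩ := z
  rfl

lemma exists_inl_or_inr
    (z : (pushout ((tensor.obj A).map b) ((tensor.map a).app B)).obj (op R)) :
    (∃ w, (pushout.inl ((tensor.obj A).map b) ((tensor.map a).app B)).app (op R) w = z) ∨
      ∃ w, (pushout.inr ((tensor.obj A).map b) ((tensor.map a).app B)).app (op R) w = z :=
  (Types.eq_or_eq_of_isPushout ((IsPushout.of_hasPushout ((tensor.obj A).map b)
    ((tensor.map a).app B)).map ((evaluation _ _).obj (op R))) z)

/-- The two normal forms share the same `corestrict`. The `A`-component of one and the `B`-component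
of the other form an element of `A ⊗ B` which maps to both. -/
lemma inl_eq_inr [Mono a] [Mono b] {z : (tensorObj A (yoneda.obj T)).obj (op R)}
    {z' : (tensorObj (yoneda.obj S) B).obj (op R)}
    (h : (tensorEval a (𝟙 (yoneda.obj T))).app (op R) z =
      (tensorEval (𝟙 (yoneda.obj S)) b).app (op R) z') :
    (pushout.inl ((tensor.obj A).map b) ((tensor.map a).app B)).app (op R) z =
      (pushout.inr ((tensor.obj A).map b) ((tensor.map a).app B)).app (op R) z' := by
  obtain ⟨ψ, hψ⟩ : ∃ ψ, (tensorEval (𝟙 (yoneda.obj S)) b).app (op R) z' = ψ := ⟨_, rfl⟩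
  obtain ⟨x, y, hx, hy, rfl⟩ :=
    exists_eq_tensorMk (a := a) (b := 𝟙 (yoneda.obj T)) z ψ (h.trans hψ)
  obtain ⟨x', y', hx', hy', rfl⟩ :=
    exists_eq_tensorMk (a := 𝟙 (yoneda.obj S)) (b := b) z' ψ hψ
  let w : ((tensor.obj A).obj B).obj (op R) := tensorMk x y' ψ.corestrict
  have h1 : tensorMk x y ψ.corestrict = ((tensor.obj A).map b).app (op R) w :=
    congrArg (fun t => tensorMk x t ψ.corestrict) (hy.trans hy'.symm)
  have h2 : tensorMk x' y' ψ.corestrict = ((tensor.map a).app B).app (op R) w :=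
    congrArg (fun t => tensorMk t y' ψ.corestrict) (hx'.trans hx.symm)
  rw [h1, h2]
  exact ConcreteCategory.congr_hom (NatTrans.congr_app (pushout.condition
    (f := (tensor.obj A).map b) (g := (tensor.map a).app B)) (op R)) w

instance [Mono a] [Mono b] : Mono (pushoutProductEval a b) := by
  rw [NatTrans.mono_iff_mono_app]
  rintro ⟨R⟩
  rw [mono_iff_injective]
  intro z z' h
  rcases exists_inl_or_inr a b z with ⟨w, rfl⟩ | ⟨w, rfl⟩ <;>
    rcases exists_inl_or_inr a b z' with ⟨w', rfl⟩ | ⟨w', rfl⟩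
  · exact congrArg _ (tensorEval_injective ((pushoutProductEval_inl a b w).symm.trans
      (h.trans (pushoutProductEval_inl a b w'))))
  · exact inl_eq_inr a b ((pushoutProductEval_inl a b w).symm.trans
      (h.trans (pushoutProductEval_inr a b w')))
  · exact (inl_eq_inr a b ((pushoutProductEval_inl a b w').symm.trans
      (h.symm.trans (pushoutProductEval_inr a b w)))).symm
  · exact congrArg _ (tensorEval_injective ((pushoutProductEval_inr a b w).symm.trans
      (h.trans (pushoutProductEval_inr a b w'))))

lemma hasLiftingProperty_pushoutProduct [Mono a] [Mono b] {E F : ClosedDendroidalSet} {p : E ⟶ F}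
    (h : HasLiftingProperty (Subfunctor.range (pushoutProductEval a b)).ι p) :
    HasLiftingProperty (pushoutProduct a b) p := by
  have e : CategoryTheory.Arrow.mk (pushoutProduct a b) ≅
      CategoryTheory.Arrow.mk (Subfunctor.range (pushoutProductEval a b)).ι :=
    CategoryTheory.Arrow.isoMk (asIso (Subfunctor.toRange (pushoutProductEval a b)))
      (show tensorObj (yoneda.obj S) (yoneda.obj T) ≅ treeTensor S T from
        asIso (tensorEval (𝟙 (yoneda.obj S)) (𝟙 (yoneda.obj T)))) (Subfunctor.toRange_ι _)
  rwa [HasLiftingProperty.iff_of_arrow_iso_left e]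

end PushoutProduct

/-- The dendrices of `∂S ⊗ T ∪ S ⊗ Λ^e T`. -/
lemma mem_range_pushoutProductEval_iff {S T : ClosedTree} {e : T.Edge} (he : T.IsVeryInner e)
    {R : ClosedTree} (ψ : TreeTensor S T R) :
    ψ ∈ (Subfunctor.range (pushoutProductEval (boundary S).ι (horn T e).ι)).obj (op R) ↔
      (∃ s, ∀ r, (ψ.1 r).1 ≠ s) ∨ ∃ d, d ≠ e ∧ ∀ r, (ψ.1 r).2 ≠ d := by
  constructor
  · rintro ⟨z, hz⟩
    rcases exists_inl_or_inr _ _ z with ⟨w, rfl⟩ | ⟨w, rfl⟩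
    · left
      obtain rfl := (pushoutProductEval_inl _ _ w).symm.trans hz
      obtain ⟨S', T', x, y, φ⟩ := w
      obtain ⟨s, hs⟩ := not_forall.1 x.2
      exact ⟨s, fun r hr => hs ⟨_, hr⟩⟩
    · right
      obtain rfl := (pushoutProductEval_inr _ _ w).symm.trans hz
      obtain ⟨S', T', x, y, φ⟩ := w
      obtain ⟨d, hd, hs⟩ := (mem_horn_iff he _).1 y.2
      exact ⟨d, hd, fun r hr => hs ⟨_, hr⟩⟩
  · rintro (⟨s, hs⟩ | ⟨d, hd, hs⟩)
    · refine ⟨_, (pushoutProductEval_inl _ _ (tensorMk (X := (boundary S).toFunctor)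
        (Y := yoneda.obj T) ⟨ψ.fstFace, fun h => ?_⟩ ψ.sndFace ψ.corestrict)).trans ?_⟩
      · obtain ⟨r, hr⟩ := h s
        obtain ⟨r', hr'⟩ := subTreeLabel_mem ψ.isTreeLike_fst r
        exact hs r' (hr'.trans hr)
      · exact ψ.push_corestrict
    · refine ⟨_, (pushoutProductEval_inr _ _ (tensorMk (X := yoneda.obj S)
        (Y := (horn T e).toFunctor) ψ.fstFace ⟨ψ.sndFace, (mem_horn_iff he _).2 ⟨d, hd, ?_⟩⟩
          ψ.corestrict)).trans ?_⟩
      · rintro ⟨r, hr⟩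
        obtain ⟨r', hr'⟩ := subTreeLabel_mem ψ.isTreeLike_snd r
        exact hs r' (hr'.trans hr)
      · exact ψ.push_corestrict

/-! ### Faces of shuffles -/

/-- The numbering selects one edge of `S` among incomparable candidates; the bound `N` allows a
lexicographic order to be written as one number. -/
lemma exists_injective_monotone_nat (α : Type*) [PartialOrder α] [Finite α] :
    ∃ (N : ℕ) (r : α → ℕ), Function.Injective r ∧ Monotone r ∧ ∀ a, r a < N := by
  have : Fintype (LinearExtension α) := @Fintype.ofFinite _ (inferInstanceAs (Finite α))
  let u := (Fintype.orderIsoFinOfCardEq (LinearExtension α) rfl).symm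
  refine ⟨_, fun a => (u (toLinearExtension a) : ℕ), fun a b h => ?_, fun a b h => ?_,
    fun a => (u _).2⟩
  · exact u.injective (Fin.ext h)
  · exact u.monotone (toLinearExtension.monotone h)

variable {S T R : ClosedTree}

/-- A set of pairs of edges is the set of labels of a dendrex of `S ⊗ T`. -/
structure IsTreeSet (B : Set (S.Edge × T.Edge)) : Prop where
  exists_min : ∃ m ∈ B, ∀ x ∈ B, m ≤ x
  comparable : ∀ x ∈ B, ∀ y ∈ B, x ≤ y ∨ y ≤ x ∨ Incomp x.1 y.1 ∨ Incomp x.2 y.2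

lemma TreeTensor.isTreeSet_range (ψ : TreeTensor S T R) : IsTreeSet (Set.range ψ.1) where
  exists_min := ⟨_, ⟨⊥, rfl⟩, by
    rintro _ ⟨r, rfl⟩
    exact ψ.monotone bot_le⟩
  comparable := by
    rintro _ ⟨a, rfl⟩ _ ⟨b, rfl⟩
    by_cases hab : a ≤ b
    · exact Or.inl (ψ.monotone hab)
    by_cases hba : b ≤ a
    · exact Or.inr (Or.inl (ψ.monotone hba))
    exact Or.inr (Or.inr (ψ.incomp ⟨hab, hba⟩))

lemma TreeTensor.isLabelling (ψ : TreeTensor S T R) : IsLabelling ψ.1 :=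
  ⟨fun _ _ h => ψ.monotone h, fun _ _ h => (ψ.incomp h).elim
    (fun k => ⟨fun h => k.1 h.1, fun h => k.2 h.1⟩) fun k => ⟨fun h => k.1 h.2, fun h => k.2 h.2⟩⟩

lemma IsTreeSet.isTreeLike {B : Set (S.Edge × T.Edge)} (hB : IsTreeSet B) : IsTreeLike B where
  exists_min := hB.exists_min
  total x hx y hy z _ hxz hyz := by
    rcases hB.comparable x hx y hy with h | h | h | h
    · exact Or.inl h
    · exact Or.inr h
    · exact ((S.total_below hxz.1 hyz.1).elim h.1 h.2).elim
    · exact ((T.total_below hxz.2 hyz.2).elim h.1 h.2).elim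

/-- The nondegenerate dendrex of `S ⊗ T` with a given set of labels. -/
def IsTreeSet.cell {B : Set (S.Edge × T.Edge)} (hB : IsTreeSet B) :
    TreeTensor S T (subTree hB.isTreeLike) :=
  ⟨subTreeLabel hB.isTreeLike, (isTensorDendrex_iff _).2
    ⟨fun _ _ => (subTreeLabel_le_iff hB.isTreeLike).2, fun a b h => by
      have h' := (subTreeLabel_incomp_iff hB.isTreeLike).2 h
      rcases hB.comparable _ (subTreeLabel_mem hB.isTreeLike a) _
        (subTreeLabel_mem hB.isTreeLike b) with k | k | k
      · exact (h'.1 k).elim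
      · exact (h'.2 k).elim
      · exact k⟩⟩

lemma IsTreeSet.range_cell {B : Set (S.Edge × T.Edge)} (hB : IsTreeSet B) :
    Set.range hB.cell.1 = B :=
  range_subTreeLabel _

/-- A subpresheaf of `S ⊗ T` contains a dendrex with a given set of labels. -/
def HasFace (Z : Subfunctor (treeTensor S T)) (B : Set (S.Edge × T.Edge)) : Prop :=
  ∃ (R : ClosedTree) (φ : TreeTensor S T R), φ ∈ Z.obj (op R) ∧ Set.range φ.1 = B

/-- Membership depends only on the set of labels, since a labelling with labels in `B` is a
restriction of any labelling with image `B`. -/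
lemma HasFace.mem {Z : Subfunctor (treeTensor S T)} {B : Set (S.Edge × T.Edge)}
    (h : HasFace Z B) {ψ : TreeTensor S T R} (hψ : Set.range ψ.1 ⊆ B) : ψ ∈ Z.obj (op R) := by
  obtain ⟨R', φ, hφ, rfl⟩ := h
  obtain ⟨k, hk⟩ := ψ.isLabelling.exists_factor_of_range_subset φ.isLabelling hψ
  have h : (treeTensor S T).map k.op φ = ψ := Subtype.ext (funext hk)
  exact (congrArg (· ∈ Z.obj (op R)) h).mp (Z.map k.op hφ)

lemma HasFace.mono {Z Z' : Subfunctor (treeTensor S T)} {B : Set (S.Edge × T.Edge)}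
    (h : HasFace Z B) (hZ : Z ≤ Z') : HasFace Z' B := by
  obtain ⟨R, φ, hφ, hB⟩ := h
  exact ⟨R, φ, hZ _ hφ, hB⟩

lemma HasFace.subset {Z : Subfunctor (treeTensor S T)} {B C : Set (S.Edge × T.Edge)}
    (h : HasFace Z B) (hC : IsTreeSet C) (hCB : C ⊆ B) : HasFace Z C :=
  ⟨_, hC.cell, h.mem (hC.range_cell.trans_subset hCB), hC.range_cell⟩

/-- A set of pairs of edges is full if its projections contain all edges of `S` and all edges of `T`
other than `e`. -/
def IsFull (e : T.Edge) (B : Set (S.Edge × T.Edge)) : Prop :=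
  (∀ s, ∃ y ∈ B, y.1 = s) ∧ ∀ d, d ≠ e → ∃ y ∈ B, y.2 = d

lemma IsFull.mono {e : T.Edge} {B C : Set (S.Edge × T.Edge)} (h : IsFull e B) (hBC : B ⊆ C) :
    IsFull e C :=
  ⟨fun s => (h.1 s).imp fun _ hy => ⟨hBC hy.1, hy.2⟩,
    fun d hd => (h.2 d hd).imp fun _ hy => ⟨hBC hy.1, hy.2⟩⟩

/-- The edge `s` is the smallest one which occurs together with an edge above `e`. -/
def IsPivot (r : S.Edge → ℕ) (e : T.Edge) (B : Set (S.Edge × T.Edge)) (s : S.Edge) : Prop :=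
  (∃ y ∈ B, y.1 = s ∧ e < y.2) ∧ ∀ y ∈ B, e < y.2 → r s ≤ r y.1

/-! ### Adding the pivot pair to a full tree set -/

section Pivot

variable {r : S.Edge → ℕ} {e : T.Edge} {B C : Set (S.Edge × T.Edge)} {s s' : S.Edge}

/-- The pivot only sees pairs strictly above `e`, so it is insensitive to pairs `(s', e)`. -/
lemma IsPivot.of_forall_mem_iff (h : IsPivot r e B s) (hBC : ∀ y, e < y.2 → (y ∈ B ↔ y ∈ C)) :
    IsPivot r e C s := by
  obtain ⟨⟨y, hy, hys, hey⟩, h⟩ := h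
  exact ⟨⟨y, (hBC y hey).1 hy, hys, hey⟩, fun y hy hey => h y ((hBC y hey).2 hy) hey⟩

lemma IsPivot.eq (hr : Function.Injective r) (h : IsPivot r e B s) (h' : IsPivot r e B s') :
    s = s' := by
  obtain ⟨⟨y, hy, rfl, hey⟩, h⟩ := h
  obtain ⟨⟨y', hy', rfl, hey'⟩, h'⟩ := h'
  exact hr (le_antisymm (h y' hy' hey') (h' y hy hey))

lemma IsPivot.insert (h : IsPivot r e B s) : IsPivot r e (insert (s', e) B) s :=
  h.of_forall_mem_iff fun y hey => by
    have : y ≠ (s', e) := by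
      rintro rfl
      exact hey.false
    simp [this]

/-- Fullness provides a pair whose second entry is an input of `e`; such an input exists because `e`
is not attached to a stump. -/
lemma exists_isPivot (r : S.Edge → ℕ) (he : T.IsVeryInner e) (hB : IsFull e B) :
    ∃ s, IsPivot r e B s := by
  obtain ⟨a, ha⟩ := he.2
  have hea : e < a := (show e ⋖ a from ha).1
  obtain ⟨y, hy, rfl⟩ := hB.2 a hea.ne'
  obtain ⟨z, ⟨hz, hez⟩, hmin⟩ := Set.exists_min_image {y ∈ B | e < y.2} (fun y => r y.1)
    (Set.toFinite _) ⟨y, hy, hea⟩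
  exact ⟨z.1, ⟨z, hz, rfl, hez⟩, fun y hy hey => hmin y ⟨hy, hey⟩⟩

lemma IsTreeSet.bot_mem (hB : IsTreeSet B) (he : e ≠ ⊥) (hf : IsFull e B) :
    (⊥ : S.Edge × T.Edge) ∈ B := by
  obtain ⟨m, hm, hmin⟩ := hB.exists_min
  obtain ⟨y, hy, hy1⟩ := hf.1 ⊥
  obtain ⟨z, hz, hz2⟩ := hf.2 ⊥ he.symm
  have : m = ⊥ := Prod.ext (le_bot_iff.1 ((hmin y hy).1.trans hy1.le))
    (le_bot_iff.1 ((hmin z hz).2.trans hz2.le))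
  rwa [← this]

lemma IsTreeSet.subset (hB : IsTreeSet B) (hCB : C ⊆ B) (hC : (⊥ : S.Edge × T.Edge) ∈ C) :
    IsTreeSet C :=
  ⟨⟨⊥, hC, fun _ _ => bot_le⟩, fun x hx y hy => hB.comparable x (hCB hx) y (hCB hy)⟩

/-- Let `(s, t) ∈ B` with `e < t` realise the pivot. The relation of `y ∈ B` to `(s, t)` is
transferred to `(s, e)`. The critical case is `y.1 ≤ s` and `e < y.2`, where `y` and `(s, e)` might
cross; minimality of `s` then forces `y.1 = s`. -/
lemma IsTreeSet.insert (hr : Function.Injective r) (hr' : Monotone r) (hB : IsTreeSet B)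
    (he : e ≠ ⊥) (hf : IsFull e B) (hs : IsPivot r e B s) : IsTreeSet (insert (s, e) B) := by
  have key (y) (hy : y ∈ B) :
      y ≤ (s, e) ∨ (s, e) ≤ y ∨ Incomp y.1 s ∨ Incomp y.2 e := by
    obtain ⟨⟨⟨s, t⟩, hy₀, rfl, het⟩, hs⟩ := hs
    have hle (h1 : y.1 ≤ s) (h2 : e < y.2) : (s, e) ≤ y :=
      ⟨(hr (le_antisymm (hr' h1) (hs y hy h2))).ge, h2.le⟩
    rcases hB.comparable y hy _ hy₀ with h | h | h | h
    · rcases T.total_below h.2 het.le with k | k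
      · exact Or.inl ⟨h.1, k⟩
      · rcases k.eq_or_lt with k | k
        · exact Or.inl ⟨h.1, k.ge⟩
        · exact Or.inr (Or.inl (hle h.1 k))
    · exact Or.inr (Or.inl ⟨h.1, het.le.trans h.2⟩)
    · exact Or.inr (Or.inr (Or.inl h))
    · by_cases h1 : y.2 ≤ e
      · exact (h.1 (h1.trans het.le)).elim
      by_cases h2 : e ≤ y.2
      · by_cases h3 : s ≤ y.1
        · exact Or.inr (Or.inl ⟨h3, h2⟩)
        by_cases h4 : y.1 ≤ s
        · exact Or.inr (Or.inl (hle h4 (lt_of_le_not_ge h2 h1)))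
        exact Or.inr (Or.inr (Or.inl ⟨h4, h3⟩))
      · exact Or.inr (Or.inr (Or.inr ⟨h1, h2⟩))
  refine ⟨⟨⊥, Or.inr (hB.bot_mem he hf), fun _ _ => bot_le⟩, ?_⟩
  rintro x (rfl | hx) y (rfl | hy)
  · exact Or.inl le_rfl
  · rcases key y hy with h | h | h | h
    · exact Or.inr (Or.inl h)
    · exact Or.inl h
    · exact Or.inr (Or.inr (Or.inl h.symm))
    · exact Or.inr (Or.inr (Or.inr h.symm))
  · exact key x hx
  · exact hB.comparable x hx y hy

end Pivot

/-- Given a downward closed family of tree sets which contains all those that are not full, there is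
a tree set `D` outside of it which can be added to the family along a very inner horn. -/
lemma exists_minimal_face {r : S.Edge → ℕ} {N : ℕ} (hr : Function.Injective r) (hr' : Monotone r)
    (hN : ∀ a, r a < N) {e : T.Edge} (he : T.IsVeryInner e)
    {F : Set (S.Edge × T.Edge) → Prop} (hF : ∀ B C, F B → IsTreeSet C → C ⊆ B → F C)
    (hfull : ∀ B, IsTreeSet B → ¬ IsFull e B → F B) (hne : ∃ B, IsTreeSet B ∧ ¬ F B) :
    ∃ D s, IsTreeSet D ∧ IsFull e D ∧ IsPivot r e D s ∧ (s, e) ∈ D ∧ ¬ F D ∧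
      ∀ C, IsTreeSet C → C ⊆ D → (∃ b ∈ D, b ≠ (s, e) ∧ b ∉ C) → F C := by
  let A : Set (Set (S.Edge × T.Edge) × S.Edge) := {x | IsTreeSet x.1 ∧ IsFull e x.1 ∧
    IsPivot r e x.1 x.2 ∧ (x.2, e) ∈ x.1 ∧ ¬ F x.1}
  have hins {B s} (hB : IsTreeSet B) (hf : IsFull e B) (hs : IsPivot r e B s) (hFB : ¬ F B) :
      (insert (s, e) B, s) ∈ A :=
    ⟨hB.insert hr hr' he.1 hf hs, hf.mono (Set.subset_insert _ _), hs.insert,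
      Set.mem_insert _ _, fun h => hFB (hF _ _ h hB (Set.subset_insert _ _))⟩
  obtain ⟨B₀, hB₀, hFB₀⟩ := hne
  have hf₀ : IsFull e B₀ := by
    by_contra h
    exact hFB₀ (hfull _ hB₀ h)
  obtain ⟨s₀, hs₀⟩ := exists_isPivot r he hf₀
  -- Since `N - r s < N + 1`, this weight orders first by the size of `D` and then by decreasing `r
  -- s`.
  obtain ⟨⟨D, s⟩, ⟨hD, hf, hs, hsD, hFD⟩, hmin⟩ := Set.exists_min_image A
    (fun x => x.1.ncard * (N + 1) + (N - r x.2)) (Set.toFinite _) ⟨_, hins hB₀ hf₀ hs₀ hFB₀⟩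
  refine ⟨D, s, hD, hf, hs, hsD, hFD, fun C hC hCD => ?_⟩
  rintro ⟨b, hbD, hbs, hbC⟩
  by_contra hFC
  have hfC : IsFull e C := by
    by_contra h
    exact hFC (hfull _ hC h)
  obtain ⟨s', hs'⟩ := exists_isPivot r he hfC
  have hle := hmin _ (hins hC hfC hs' hFC)
  dsimp only at hle
  -- A subset has fewer pairs above `e`, so its pivot can only come later.
  have hss' : r s ≤ r s' := by
    obtain ⟨⟨y, hy, rfl, hey⟩, -⟩ := hs'
    exact hs.2 y (hCD hy) hey
  have h1 : C.ncard < D.ncard :=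
    Set.ncard_lt_ncard ⟨hCD, fun h => hbC (h hbD)⟩ (Set.toFinite _)
  have h2 : (insert (s', e) C).ncard ≤ C.ncard + 1 := Set.ncard_insert_le _ _
  have hNs := hN s
  have hNs' := hN s'
  -- Either the completion of `C` is smaller than `D`, against minimality, or it has the same size.
  -- Then the choice of the largest `r s` gives `s' = s`, so the completion is `D` and contains `b`.
  rcases (show (insert (s', e) C).ncard ≤ D.ncard by omega).lt_or_eq with h | h
  · have : ((insert (s', e) C).ncard + 1) * (N + 1) ≤ D.ncard * (N + 1) :=
      Nat.mul_le_mul_right _ h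
    rw [add_mul] at this
    omega
  · rw [h] at hle
    obtain rfl : s' = s := hr (by omega)
    have hCD' : insert (s', e) C = D :=
      Set.eq_of_subset_of_ncard_le (Set.insert_subset hsD hCD) h.ge (Set.toFinite _)
    rw [← hCD'] at hbD
    exact hbD.elim hbs hbC

/-! ### Pushout-products with very inner horns -/

section Core

variable {S T R : ClosedTree} {e : T.Edge}

lemma mem_range_pushoutProductEval_iff_not_isFull (he : T.IsVeryInner e) (ψ : TreeTensor S T R) :
    ψ ∈ (Subfunctor.range (pushoutProductEval (boundary S).ι (horn T e).ι)).obj (op R) ↔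
      ¬ IsFull e (Set.range ψ.1) := by
  rw [mem_range_pushoutProductEval_iff he]
  rw [IsFull, not_and_or]
  simp

lemma injectiveRel_cell (Z : Subfunctor (treeTensor S T)) {D : Set (S.Edge × T.Edge)}
    (hD : IsTreeSet D) : InjectiveRel Z (S := subTree hD.isTreeLike) hD.cell := by
  intro R f f' h _
  exact hom_ext fun a => subTreeLabel_injective hD.isTreeLike
    (congrArg (fun t : TreeTensor S T R => t.1 a) h)

lemma cellBoundary_cell_eq_horn {Z : Subfunctor (treeTensor S T)} {D : Set (S.Edge × T.Edge)}
    (hD : IsTreeSet D) {b : (subTree hD.isTreeLike).Edge}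
    (hb : (subTree hD.isTreeLike).IsVeryInner b)
    (hZ : ∀ C, IsTreeSet C → C ⊆ D →
      (HasFace Z C ↔ ∃ d ∈ D, d ≠ subTreeLabel hD.isTreeLike b ∧ d ∉ C)) :
    cellBoundary Z (S := subTree hD.isTreeLike) hD.cell = horn (subTree hD.isTreeLike) b := by
  ext ⟨R⟩ f
  have hsub : Set.range (hD.cell.restrict f).1 ⊆ D := by
    rintro _ ⟨a, rfl⟩
    exact subTreeLabel_mem _ _
  change hD.cell.restrict f ∈ Z.obj (op R) ↔ f ∈ _
  rw [mem_horn_iff hb]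
  have h1 : hD.cell.restrict f ∈ Z.obj (op R) ↔ HasFace Z (Set.range (hD.cell.restrict f).1) :=
    ⟨fun h => ⟨_, _, h, rfl⟩, fun h => h.mem subset_rfl⟩
  rw [h1, hZ _ (hD.cell.restrict f).isTreeSet_range hsub]
  constructor
  · rintro ⟨d, hd, hdb, hdf⟩
    obtain ⟨c, rfl⟩ := exists_subTreeLabel_eq hD.isTreeLike hd
    refine ⟨c, fun h => hdb (by rw [h]), ?_⟩
    rintro ⟨a, rfl⟩
    exact hdf ⟨a, rfl⟩
  · rintro ⟨c, hcb, hcf⟩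
    refine ⟨_, subTreeLabel_mem _ c, fun h => hcb (subTreeLabel_injective _ h), ?_⟩
    rintro ⟨a, ha⟩
    exact hcf ⟨a, subTreeLabel_injective _ ha⟩

/-- The invariant is that `Z` contains, with each full tree set, its completion by the pivot pair.
Hence if `D` is missing from `Z`, so is its face without `(s, e)`, and `D` meets `Z` in exactly the
horn. -/
lemma hasLiftingProperty_range_pushoutProductEval (he : T.IsVeryInner e)
    {E B : ClosedDendroidalSet} {p : E ⟶ B} (hp : veryInnerHornInclusions.rlp p) :
    HasLiftingProperty
      (Subfunctor.range (pushoutProductEval (boundary S).ι (horn T e).ι)).ι p := by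
  obtain ⟨N, r, hr, hr', hN⟩ := exists_injective_monotone_nat S.Edge
  refine hasLiftingProperty_of_cells (fun Z => ∀ B s, IsTreeSet B → IsFull e B →
    IsPivot r e B s → HasFace Z B → HasFace Z (insert (s, e) B)) ?_ ?_ ?_
  -- Vacuous: no full set is present at the start.
  · rintro B s hB hf - ⟨R, φ, hφ, rfl⟩
    exact ((mem_range_pushoutProductEval_iff_not_isFull he φ).1 hφ hf).elim
  · rintro c - - hQ B s hB hf hs ⟨R, φ, hφ, rfl⟩
    obtain ⟨Z, hZ, hφ⟩ : ∃ Z ∈ c, φ ∈ Z.obj (op R) := by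
      rw [Subfunctor.sSup_obj] at hφ
      obtain ⟨_, ⟨Z, hZ, rfl⟩, h⟩ := hφ
      exact ⟨Z, hZ, h⟩
    exact (hQ Z hZ _ s hB hf hs ⟨R, φ, hφ, rfl⟩).mono (le_sSup hZ)
  · intro Z hUZ hQ hZ
    obtain ⟨D, s, hD, hf, hs, hsD, hFD, hmin⟩ := exists_minimal_face hr hr' hN he (F := HasFace Z)
      (fun B C h => h.subset) (fun B hB hf => ⟨_, hB.cell, hUZ _ (by
        change hB.cell ∈ _
        rwa [mem_range_pushoutProductEval_iff_not_isFull he, hB.range_cell]), hB.range_cell⟩) (by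
      by_contra! h
      exact hZ (top_le_iff.1 fun R x _ =>
        (h _ (TreeTensor.isTreeSet_range (R := R.unop) x)).mem subset_rfl))
    -- Without `(s, e)` the set stays full: `s` still occurs in the pair realising the pivot, and
    -- `e` need not occur.
    have hout {C} (hC : IsTreeSet C) (hCD : C ⊆ D) (hCD' : ∀ d ∈ D, d ≠ (s, e) → d ∈ C) :
        IsFull e C ∧ IsPivot r e C s ∧ insert (s, e) C = D := by
      have hpiv : IsPivot r e C s := hs.of_forall_mem_iff fun y hey =>
        ⟨fun hy => hCD' y hy (by rintro rfl; exact hey.false), fun hy => hCD hy⟩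
      refine ⟨⟨fun s' => ?_, fun d hd => ?_⟩, hpiv, ?_⟩
      · obtain ⟨y, hy, rfl⟩ := hf.1 s'
        by_cases hys : y = (s, e)
        · obtain ⟨z, hz, hzs, -⟩ := hpiv.1
          exact ⟨z, hz, by rw [hzs, hys]⟩
        · exact ⟨y, hCD' y hy hys, rfl⟩
      · obtain ⟨y, hy, rfl⟩ := hf.2 d hd
        exact ⟨y, hCD' y hy (by rintro rfl; exact hd rfl), rfl⟩
      · refine Set.Subset.antisymm (Set.insert_subset hsD hCD) fun d hd => ?_
        by_cases h : d = (s, e)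
        · exact Or.inl h
        · exact Or.inr (hCD' d hd h)
    have hface {C} (hC : IsTreeSet C) (hCD : C ⊆ D) :
        HasFace Z C ↔ ∃ d ∈ D, d ≠ (s, e) ∧ d ∉ C := by
      refine ⟨fun h => ?_, hmin C hC hCD⟩
      by_contra! hcon
      obtain ⟨h1, h2, h3⟩ := hout hC hCD hcon
      exact hFD (h3 ▸ hQ C s hC h1 h2 h)
    obtain ⟨b, hb⟩ := exists_subTreeLabel_eq hD.isTreeLike hsD
    -- The edge `(s, e)` is not the root because `e` is not, and it has an input because the pair
    -- realising the pivot lies above it.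
    have hbi : (subTree hD.isTreeLike).IsVeryInner b := by
      constructor
      · rintro rfl
        obtain ⟨c, hc⟩ := exists_subTreeLabel_eq hD.isTreeLike (hD.bot_mem he.1 hf)
        have := (subTreeLabel_le_iff hD.isTreeLike).2 (bot_le : ⊥ ≤ c)
        rw [hb, hc] at this
        exact he.1 (le_bot_iff.1 this.2)
      · obtain ⟨y, hy, rfl, hey⟩ := hs.1
        obtain ⟨c, rfl⟩ := exists_subTreeLabel_eq hD.isTreeLike hy
        have hbc : b < c := by
          refine lt_of_le_of_ne ((subTreeLabel_le_iff hD.isTreeLike).1 ?_) ?_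
          · rw [hb]
            exact ⟨le_rfl, hey.le⟩
          · rintro rfl
            rw [hb] at hey
            exact hey.false
        obtain ⟨a, ha, -⟩ := (subTree hD.isTreeLike).exists_covBy_le hbc
        exact ⟨a, ha⟩
    refine ⟨subTree hD.isTreeLike, hD.cell, fun h => hFD ⟨_, _, h, hD.range_cell⟩,
      injectiveRel_cell Z hD, ?_, ?_⟩
    -- The only new tree sets are `D` and `D ∖ {(s, e)}`, and both have completion `D`.
    · intro C s' hC hfC hsC hZC
      by_cases hZC' : HasFace Z C
      · exact (hQ C s' hC hfC hsC hZC').mono le_sup_left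
      · obtain ⟨R, φ, hφ | ⟨f, hφ⟩, rfl⟩ := hZC
        · exact (hZC' ⟨R, φ, hφ, rfl⟩).elim
        · have hsub : Set.range φ.1 ⊆ D := by
            rintro _ ⟨a, rfl⟩
            rw [← hφ]
            exact subTreeLabel_mem _ _
          rw [hface hC hsub] at hZC'
          push Not at hZC'
          obtain ⟨-, h2, h3⟩ := hout hC hsub hZC'
          rw [hsC.eq hr h2, h3]
          exact ⟨_, hD.cell, Or.inr (Subfunctor.mem_ofSection_obj _), hD.range_cell⟩
    · rw [cellBoundary_cell_eq_horn hD hbi (fun C hC hCD => by rw [hb, hface hC hCD])]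
      exact hp _ ⟨(⟨_, b, hbi⟩ : Σ T : ClosedTree, {e : T.Edge // T.IsVeryInner e})⟩

end Core

/-! ### Reduction to boundaries and very inner horns -/

lemma IsVeryInnerAnodyne.hasLiftingProperty {X Y E B : ClosedDendroidalSet} {j : X ⟶ Y}
    (hj : IsVeryInnerAnodyne j) {p : E ⟶ B}
    (hp : ∀ (T : ClosedTree) (e : T.Edge), T.IsVeryInner e → HasLiftingProperty (horn T e).ι p) :
    HasLiftingProperty j p := by
  refine hj (ofHoms fun _ : Unit => p).llp (isSaturated_llp _) ?_ _ ⟨()⟩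
  rintro _ _ _ ⟨T, e, he⟩ _ _ _ ⟨⟩
  exact hp T e he

/-- With `i` moved to the right-hand side, `j` may be replaced by a very inner horn inclusion; with
this horn moved there instead, `i` may be replaced by a boundary inclusion. -/
lemma IsVeryInnerAnodyne.pushoutProduct_lift {U X V Y E B : ClosedDendroidalSet} {i : U ⟶ X}
    {j : V ⟶ Y} (hi : IsNormalMono i) (hj : IsVeryInnerAnodyne j) {p : E ⟶ B}
    (hp : veryInnerHornInclusions.rlp p) : HasLiftingProperty (pushoutProduct i j) p := by
  rw [pushoutProduct_lift_iff]
  refine hj.hasLiftingProperty fun T e he => ?_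
  rw [← pushoutProduct_lift_iff, pushoutProduct_lift_iff']
  refine hi.hasLiftingProperty fun S => ?_
  rw [← pushoutProduct_lift_iff']
  exact hasLiftingProperty_pushoutProduct _ _ (hasLiftingProperty_range_pushoutProductEval he hp)

end Dendroidal

end

theorem proposition7p3 {U X V Y : Dendroidal.ClosedDendroidalSet} (i : U ⟶ X) (j : V ⟶ Y)
    (hi : Dendroidal.IsNormalMono i) (hj : Dendroidal.IsNormalMono j)
    (h : Dendroidal.IsVeryInnerAnodyne i ∨ Dendroidal.IsVeryInnerAnodyne j) :
    Dendroidal.IsVeryInnerAnodyne (Dendroidal.pushoutProduct i j) := by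
  refine Dendroidal.isVeryInnerAnodyne_of_llp fun _ _ p hp => ?_
  rcases h with h | h
  · rw [Dendroidal.pushoutProduct_lift_comm]
    exact h.pushoutProduct_lift hj hp
  · exact h.pushoutProduct_lift hi hp
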